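/- Let $p$ be a prime and let $C$ be an algebraically closed field of characteristic $0$ that is complete for a nonarchimedean absolute value with $|p|<1$; let $\mathcal{O}_C$ be its ring of integers. For a $p$-adically complete ring $S$, let $S^\flat = \varprojlim_{x\mapsto x^p} S/p$ be its tilt and $W(S^\flat)$ the ring of $p$-typical Witt vectors. Put $A_{\inf} = W(\mathcal{O}_C^\flat)$, fix a compatible system $\epsilon = (1,\zeta_p,\zeta_{p^2},\dots)\in\mathcal{O}_C^\flat$ of primitive $p$-power roots of unity, and set $$\mu = [\epsilon]-1,\qquad \xi=\sum_{i=0}^{p-1}[\epsilon^{1/p}]^i \quad\text{in } A_{\inf},$$ so that $\xi$ generates the kernel of $\theta\colon A_{\inf}\twoheadrightarrow\mathcal{O}_C$. Let $\mathrm{Spa}(R'_\infty[\tfrac1p],R'_\infty)$ be a (nonempty) affinoid perfectoid over $\mathrm{Spa}(C,\mathcal{O}_C)$: $R'_\infty[\tfrac1p]$ is a nonzero perfectoid Banach $C$-algebra (its subring of power-bounded elements is bounded and has surjective Frobenius modulo $p$), and $R'_\infty$ is an open, integrally closed subring of it that consists of power-bounded elements and contains the image of $\mathcal{O}_C$. Put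 $\mathbb{A}_{\inf}(R'_\infty)=W(R_\infty'^\flat)$, an $A_{\inf}$-algebra. For $m\in\mathbb{Z}_{\ge1}$, let $\mathbb{A}^{0,(m)}_{\mathrm{cris}}(R'_\infty)$ (resp. $\mathbb{A}^{0}_{\mathrm{cris}}(R'_\infty)$) be the $\mathbb{A}_{\inf}(R'_\infty)$-subalgebra of $\mathbb{A}_{\inf}(R'_\infty)[\tfrac1p]$ generated by the elements $\xi^n/n!$ with $1\le n\le m$ (resp. with $n\ge1$), and write $A^{0,(m)}_{\mathrm{cris}}$, $A^0_{\mathrm{cris}}$ for the analogous subalgebras of $A_{\inf}[\tfrac1p]$. Let $A^{(m)}_{\mathrm{cris}}$ and $A_{\mathrm{cris}}$ be the $(p,\mu)$-adic completions of $A^{0,(m)}_{\mathrm{cris}}$ and $A^0_{\mathrm{cris}}$, put $$\mathbb{A}^{(m)}_{\mathrm{cris}}(R'_\infty)=\mathbb{A}_{\inf}(R'_\infty)\,\widehat\otimes_{A_{\inf}}A^{(m)}_{\mathrm{cris}},\qquad \mathbb{A}_{\mathrm{cris}}(R'_\infty)=\mathbb{A}_{\inf}(R'_\infty)\,\widehat\otimes_{A_{\inf}}A_{\mathrm{cris}}$$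 with $(p,\mu)$-adic completions (for $A_{\mathrm{cris}}$, and for $A_{\mathrm{cris}}^{(m)}$ with $m\ge p$, these agree with the $p$-adic ones), and let $\mathbb{B}_{\mathrm{dR}}^+(R'_\infty)$ be the $\xi$-adic completion of $\mathbb{A}_{\inf}(R'_\infty)[\tfrac1p]$. Then for every $m\ge1$: 1. There is a unique $\mathbb{A}_{\inf}(R'_\infty)$-algebra homomorphism $a\colon\mathbb{A}^{0,(m)}_{\mathrm{cris}}(R'_\infty)\to\mathbb{A}^{(m)}_{\mathrm{cris}}(R'_\infty)$ that sends the image of each $x\in A^{0,(m)}_{\mathrm{cris}}$ to $1\otimes x$. Let $b\colon \mathbb{A}^{(m)}_{\mathrm{cris}}(R'_\infty)\to\mathbb{A}_{\mathrm{cris}}(R'_\infty)$ be the map induced by the inclusion $A^{0,(m)}_{\mathrm{cris}}\subset A^0_{\mathrm{cris}}$. There is a unique $\mathbb{A}_{\inf}(R'_\infty)$-algebra homomorphism $c\colon\mathbb{A}_{\mathrm{cris}}(R'_\infty)\to\mathbb{B}_{\mathrm{dR}}^+(R'_\infty)$ that sends $1\otimes x$ to the image of $x$ for each $x\in A^0_{\mathrm{cris}}$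 and satisfies, for every $n\ge 0$, $c(\mathbb{A}_{\mathrm{cris}}(R'_\infty))\subset \mathrm{im}(\mathbb{A}^0_{\mathrm{cris}}(R'_\infty))+\xi^n\,\mathbb{B}_{\mathrm{dR}}^+(R'_\infty)$. 2. The ring homomorphisms $$\mathbb{A}^{0,(m)}_{\mathrm{cris}}(R'_\infty)\xrightarrow{\,a\,}\mathbb{A}^{(m)}_{\mathrm{cris}}(R'_\infty)\xrightarrow{\,b\,}\mathbb{A}_{\mathrm{cris}}(R'_\infty)\xrightarrow{\,c\,}\mathbb{B}_{\mathrm{dR}}^+(R'_\infty)$$ are all injective. 3. None of these four $A_{\inf}$-algebras has nonzero $\mu$-torsion. -/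

import Mathlib

open scoped TensorProduct

noncomputable section

namespace AcrisInj

universe u v

/-! ### Completions and divided power subalgebras -/

theorem completionMap_compat {R : Type*} {S : Type*} {S' : Type*} [CommRing R] [CommRing S]
    [CommRing S'] [Algebra R S] [Algebra R S'] (I : Ideal S) (J : Ideal S') (f : S →ₐ[R] S')
    (h : ∀ n, I ^ n ≤ (J ^ n).comap f) {m n : ℕ} (hle : m ≤ n) :
    (Ideal.Quotient.factorₐ R (Ideal.pow_le_pow_right hle)).comp
      ((Ideal.quotientMapₐ (J ^ n) f (h n)).comp ((AdicCompletion.evalₐ I n).restrictScalars R)) =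
    (Ideal.quotientMapₐ (J ^ m) f (h m)).comp ((AdicCompletion.evalₐ I m).restrictScalars R) := by
  ext x
  obtain ⟨x, rfl⟩ := AdicCompletion.mk_surjective I S x
  have e := AdicCompletion.Ideal.mk_eq_mk I hle x
  have h2 : ∀ k (y : S), Ideal.quotientMapₐ (J ^ k) f (h k)
      (Ideal.Quotient.mk (I ^ k) y) = Ideal.Quotient.mk (J ^ k) (f y) := fun _ _ => rfl
  have h3 : ∀ y : S', Ideal.Quotient.factorₐ R (Ideal.pow_le_pow_right hle)
      (Ideal.Quotient.mk (J ^ n) y) = Ideal.Quotient.mk (J ^ m) y := fun _ => rfl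
  simp only [AlgHom.coe_comp, Function.comp_apply, AlgHom.coe_restrictScalars',
    AdicCompletion.evalₐ_mk]
  rw [← e, h2, h2, h3]

theorem pow_le_comap_pow {R : Type*} {S : Type*} {S' : Type*} [CommRing R] [CommRing S]
    [CommRing S'] [Algebra R S] [Algebra R S'] {I : Ideal S} {J : Ideal S'} {f : S →ₐ[R] S'}
    (h : I ≤ J.comap f) (n : ℕ) : I ^ n ≤ (J ^ n).comap f :=
  (Ideal.pow_right_mono h n).trans (Ideal.le_comap_pow f n)

/-- The map `S^ → S'^` of adic completions induced by an `R`-algebra map `f : S → S'` with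
`f(I) ⊆ J`. -/
def completionMap {R : Type*} {S : Type*} {S' : Type*} [CommRing R] [CommRing S] [CommRing S']
    [Algebra R S] [Algebra R S'] (I : Ideal S) (J : Ideal S') (f : S →ₐ[R] S')
    (h : I ≤ J.comap f) : AdicCompletion I S →ₐ[R] AdicCompletion J S' :=
  AdicCompletion.liftAlgHom J
    (fun n => (Ideal.quotientMapₐ (J ^ n) f (pow_le_comap_pow h n)).comp
      ((AdicCompletion.evalₐ I n).restrictScalars R))
    (completionMap_compat I J f (pow_le_comap_pow h))

theorem completionMap_of {R : Type*} {S : Type*} {S' : Type*} [CommRing R] [CommRing S]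
    [CommRing S'] [Algebra R S] [Algebra R S'] (I : Ideal S) (J : Ideal S') (f : S →ₐ[R] S')
    (h : I ≤ J.comap f) (x : S) :
    completionMap I J f h (algebraMap S _ x) = algebraMap S' _ (f x) := by
  refine AdicCompletion.ext_evalₐ fun n => ?_
  refine (AdicCompletion.evalₐ_liftAlgHom J _
    (completionMap_compat I J f (pow_le_comap_pow h)) n _).trans ?_
  simp only [AdicCompletion.algebraMap_apply, AdicCompletion.evalₐ_of, AlgHom.coe_comp,
    Function.comp_apply, AlgHom.coe_restrictScalars', Algebra.algebraMap_self, RingHom.id_apply]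
  rfl

/-- The `W`-subalgebra of `W[1/p]` generated by the elements `ξ ^ n / n!` for `1 ≤ n ≤ m`
(for all `n ≥ 1` if `m = ⊤`). For the rings `W` of Witt vectors used below, the integers `n!` are
invertible in `W[1/p]`. -/
def dpSub (p : ℕ) (W : Type*) [CommRing W] (ξ : W) (m : ℕ∞) :
    Subalgebra W (Localization.Away (p : W)) :=
  Algebra.adjoin W
    {x | ∃ n : ℕ, 1 ≤ n ∧ (n : ℕ∞) ≤ m ∧ (n.factorial : Localization.Away (p : W)) * x =
      algebraMap W (Localization.Away (p : W)) ξ ^ n}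

theorem dpSub_mono (p : ℕ) (W : Type*) [CommRing W] (ξ : W) {m m' : ℕ∞} (h : m ≤ m') :
    dpSub p W ξ m ≤ dpSub p W ξ m' :=
  Algebra.adjoin_mono fun _ ⟨n, h1, h2, h3⟩ => ⟨n, h1, h2.trans h, h3⟩

section Generic

variable (p : ℕ) (B : Type*) [CommRing B]

/-- The ideal `(p, μ)` of a `B`-algebra `S`, for `μ` in `B`. -/
def pMuIdeal (μ : B) (S : Type*) [CommRing S] [Algebra B S] : Ideal S :=
  Ideal.span {(p : S), algebraMap B S μ}

theorem pMuIdeal_le_comap (μ : B) {S S' : Type*} [CommRing S] [Algebra B S] [CommRing S']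
    [Algebra B S'] (f : S →ₐ[B] S') : pMuIdeal p B μ S ≤ (pMuIdeal p B μ S').comap f := by
  rw [pMuIdeal, pMuIdeal, Ideal.span_le]
  intro x hx
  rw [SetLike.mem_coe, Ideal.mem_comap]
  rcases hx with hx | hx
  · rw [hx, map_natCast]
    exact Ideal.subset_span (Set.mem_insert _ _)
  · rw [Set.mem_singleton_iff.1 hx, AlgHom.commutes]
    exact Ideal.subset_span (Set.mem_insert_of_mem _ rfl)

/-- With `B = A_inf`: the ring `A_cris^(m)`, that is, the `(p, μ)`-adic completion of
`A_cris^{0,(m)} = dpSub p B ξ m`; for `m = ⊤` this is `A_cris`. -/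
abbrev CrisHat (ξ μ : B) (m : ℕ∞) : Type _ :=
  AdicCompletion (pMuIdeal p B μ (dpSub p B ξ m)) (dpSub p B ξ m)

/-- The map `A_cris^(m) → A_cris^(m')` for `m ≤ m'`, induced by the inclusion
`A_cris^{0,(m)} ⊆ A_cris^{0,(m')}`. -/
def crisHatMap (ξ μ : B) {m m' : ℕ∞} (h : m ≤ m') :
    CrisHat p B ξ μ m →ₐ[B] CrisHat p B ξ μ m' :=
  completionMap _ _ (Subalgebra.inclusion (dpSub_mono p B ξ h)) (pMuIdeal_le_comap p B μ _)

variable (W : Type*) [CommRing W] [Algebra B W]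

/-- With `B = A_inf` and `W = 𝔸_inf(R')`: the completed tensor product
`𝔸_cris^(m)(R') = 𝔸_inf(R') ⊗̂_{A_inf} A_cris^(m)`, the completion being `(p, μ)`-adic; for `m = ⊤`
this is `𝔸_cris(R')`. -/
abbrev RelCris (ξ μ : B) (m : ℕ∞) : Type _ :=
  AdicCompletion (pMuIdeal p B μ (W ⊗[B] CrisHat p B ξ μ m)) (W ⊗[B] CrisHat p B ξ μ m)

/-- The canonical map `A_cris^{0,(m)} → 𝔸_cris^(m)(R')`, `x ↦ 1 ⊗ x`. -/
def toRelCris (ξ μ : B) (m : ℕ∞) (x : dpSub p B ξ m) : RelCris p B W ξ μ m :=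
  algebraMap (W ⊗[B] CrisHat p B ξ μ m) _ (1 ⊗ₜ[B] algebraMap (dpSub p B ξ m) _ x)

/-- The map `𝔸_cris^(m)(R') → 𝔸_cris^(m')(R')` for `m ≤ m'`, induced by
`A_cris^(m) → A_cris^(m')`. -/
def relCrisMap (ξ μ : B) {m m' : ℕ∞} (h : m ≤ m') :
    RelCris p B W ξ μ m →ₐ[W] RelCris p B W ξ μ m' :=
  completionMap _ _ (Algebra.TensorProduct.map (AlgHom.id W W) (crisHatMap p B ξ μ h))
    (pMuIdeal_le_comap p B μ
      ((Algebra.TensorProduct.map (AlgHom.id W W) (crisHatMap p B ξ μ h)).restrictScalars B))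

/-- The map `A_inf[1/p] → 𝔸_inf(R')[1/p]`. -/
def locMap : Localization.Away (p : B) →+* Localization.Away (p : W) :=
  Localization.awayLift ((algebraMap W (Localization.Away (p : W))).comp (algebraMap B W)) (p : B)
    (by simpa using IsLocalization.Away.algebraMap_isUnit (S := Localization.Away (p : W)) (p : W))

/-- `𝔹_dR^+(R')`: the `ξ`-adic completion of `𝔸_inf(R')[1/p]`. -/
abbrev BdRPlus (ξ : W) : Type _ :=
  AdicCompletion (Ideal.span {algebraMap W (Localization.Away (p : W)) ξ})
    (Localization.Away (p : W))

/-- `a` is the canonical `𝔸_inf(R')`-algebra map `𝔸_cris^{0,(m)}(R') → 𝔸_cris^(m)(R')`: it sends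
the image in `𝔸_cris^{0,(m)}(R')` of an element `x` of `A_cris^{0,(m)}` to `1 ⊗ x`. -/
def IsCompletionMap (ξ μ : B) (m : ℕ∞)
    (a : dpSub p W (algebraMap B W ξ) m →ₐ[W] RelCris p B W ξ μ m) : Prop :=
  ∀ (x : dpSub p B ξ m) (y : dpSub p W (algebraMap B W ξ) m),
    locMap p B W x = y → a y = toRelCris p B W ξ μ m x

/-- `c` is the canonical `𝔸_inf(R')`-algebra map `𝔸_cris(R') → 𝔹_dR^+(R')`: on the image of
`A_cris^0` it is the map `A_cris^0 ⊆ A_inf[1/p] → 𝔸_inf(R')[1/p] → 𝔹_dR^+(R')`, and it is the limit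
over `n` of maps `𝔸_cris(R') → 𝔸_cris^0(R') / (𝔸_cris^0(R') ∩ ξ ^ n 𝔸_inf(R')[1/p])`, that is,
modulo every `ξ ^ n` its values come from `𝔸_cris^0(R') ⊆ 𝔸_inf(R')[1/p]`. -/
def IsDeRhamMap (ξ μ : B)
    (c : RelCris p B W ξ μ ⊤ →ₐ[W] BdRPlus p W (algebraMap B W ξ)) : Prop :=
  (∀ x : dpSub p B ξ ⊤,
    c (toRelCris p B W ξ μ ⊤ x) = algebraMap (Localization.Away (p : W)) _ (locMap p B W x)) ∧
  ∀ (y : RelCris p B W ξ μ ⊤) (n : ℕ), ∃ z ∈ dpSub p W (algebraMap B W ξ) ⊤,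
    ∃ w : BdRPlus p W (algebraMap B W ξ),
      c y = algebraMap (Localization.Away (p : W)) _ z +
        algebraMap W _ (algebraMap B W ξ) ^ n * w

end Generic

/-! ### The base field and its period ring -/

section Base

variable (p : ℕ) [Fact p.Prime] (C : Type u) [NormedField C] [IsUltrametricDist C]

/-- The ring of integers of `C`: the elements of norm at most `1`. -/
abbrev OC : Subring C := (NormedField.valuation (K := C)).integer

theorem mem_OC_iff {C : Type u} [NormedField C] [IsUltrametricDist C] (x : C) :
    x ∈ OC C ↔ ‖x‖ ≤ 1 := Iff.rfl

instance [Fact (‖(p : C)‖ < 1)] : Fact ¬ IsUnit (p : OC C) where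
  out h := by
    obtain ⟨y, hy⟩ := h.exists_right_inv
    have h1 : ‖(p : C)‖ * ‖(y : C)‖ = 1 := by
      rw [← norm_mul]; simpa using congrArg (fun z : OC C => ‖(z : C)‖) hy
    have h2 := (mem_OC_iff _).1 y.2
    have h3 : ‖(p : C)‖ < 1 := Fact.out
    nlinarith [norm_nonneg (p : C), norm_nonneg (y : C)]

/-- A compatible system `(1, ζ_p, ζ_{p^2}, …)` of primitive `p`-power roots of unity in `C`. -/
structure RootSystem where
  /-- the primitive `p ^ n`-th root of unity -/
  root : ℕ → C
  isPrimitiveRoot : ∀ n, IsPrimitiveRoot (root n) (p ^ n)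
  pow_root : ∀ n, root (n + 1) ^ p = root n

variable {p C}

theorem RootSystem.root_mem (ζ : RootSystem p C) (n : ℕ) : ζ.root n ∈ OC C := by
  have hp : p ^ n ≠ 0 := pow_ne_zero _ (Fact.out : p.Prime).ne_zero
  exact ((ζ.isPrimitiveRoot n).isOfFinOrder hp).norm_eq_one.le

variable [Fact (‖(p : C)‖ < 1)]

/-- `ε = (1, ζ_p, ζ_{p^2}, …)` in `O_C^♭`. -/
def RootSystem.eps (ζ : RootSystem p C) : PreTilt (OC C) p :=
  ⟨fun n => Ideal.Quotient.mk _ ⟨ζ.root n, ζ.root_mem n⟩, fun n => by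
    rw [← map_pow]
    exact congrArg _ (Subtype.ext (ζ.pow_root n))⟩

variable (p C) in
/-- `A_inf = W(O_C^♭)`. -/
abbrev Ainf : Type u := WittVector p (PreTilt (OC C) p)

/-- `μ = [ε] - 1`. -/
def RootSystem.mu (ζ : RootSystem p C) : Ainf p C := WittVector.teichmuller p ζ.eps - 1

/-- `ξ = 1 + [ε^{1/p}] + … + [ε^{1/p}] ^ (p - 1)`, the standard generator of the kernel of
`θ : A_inf → O_C`. -/
def RootSystem.xi (ζ : RootSystem p C) : Ainf p C :=
  ∑ i ∈ Finset.range p,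
    WittVector.teichmuller p ((frobeniusEquiv (PreTilt (OC C) p) p).symm ζ.eps) ^ i

end Base

/-! ### Affinoid perfectoids over `Spa(C, O_C)` -/

/-- An element of a normed ring is power-bounded if its powers are bounded in norm. -/
def PowerBounded {A : Type*} [NormedCommRing A] (x : A) : Prop :=
  ∃ b : ℝ, ∀ n : ℕ, ‖x ^ n‖ ≤ b

/-- The structure of an affinoid perfectoid `(A, A⁺)` over `Spa(C, O_C)` on a Banach `C`-algebra
`A`. The first two fields say that `A` is a perfectoid `C`-algebra: the subring `A°` of
power-bounded elements is bounded and the Frobenius of `A° / p` is surjective. The others say that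
`A⁺` is an open and integrally closed subring of `A` that lies in `A°` and contains the image of
`O_C`. -/
structure AffinoidPerfectoid (p : ℕ) (C : Type u) [NormedField C] [IsUltrametricDist C]
    (A : Type v) [NormedCommRing A] [NormedAlgebra C A] where
  bounded : ∃ b : ℝ, ∀ x : A, PowerBounded x → ‖x‖ ≤ b
  frobenius_surjective : ∀ x : A, PowerBounded x →
    ∃ y z : A, PowerBounded y ∧ PowerBounded z ∧ x = y ^ p + p * z
  /-- the ring of integral elements `A⁺` -/
  plus : Subring A
  isOpen_plus : IsOpen (plus : Set A)
  integrallyClosed_plus : ∀ x : A, IsIntegral plus x → x ∈ plus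
  powerBounded_of_mem_plus : ∀ x ∈ plus, PowerBounded x
  algebraMap_mem_plus : ∀ x ∈ OC C, algebraMap C A x ∈ plus

namespace AffinoidPerfectoid

variable {p : ℕ} [Fact p.Prime] {C : Type u} [NormedField C] [IsUltrametricDist C]
  {A : Type v} [NormedCommRing A] [NormedAlgebra C A]

instance [CharZero C] [Fact (‖(p : C)‖ < 1)] [Nontrivial A] (P : AffinoidPerfectoid p C A) :
    Fact ¬ IsUnit (p : P.plus) where
  out h := by
    obtain ⟨y, hy⟩ := h.exists_right_inv
    obtain ⟨b, hb⟩ := P.powerBounded_of_mem_plus _ y.2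
    have h1 : (p : A) * (y : A) = 1 := by simpa using congrArg Subtype.val hy
    have h3 : ‖(p : C)‖ < 1 := Fact.out
    have h1pos : 0 < ‖(1 : A)‖ := norm_pos_iff.2 one_ne_zero
    have key : ∀ n : ℕ, ‖(1 : A)‖ ≤ ‖(p : C)‖ ^ n * b := fun n => by
      have e : (1 : A) = ((p : C) ^ n) • (y : A) ^ n := by
        rw [Algebra.smul_def, map_pow, map_natCast, ← mul_pow, h1, one_pow]
      calc ‖(1 : A)‖ = ‖((p : C) ^ n) • (y : A) ^ n‖ := by rw [← e]
        _ ≤ ‖(p : C) ^ n‖ * ‖(y : A) ^ n‖ := norm_smul_le _ _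
        _ ≤ ‖(p : C)‖ ^ n * b := by
          rw [norm_pow]; exact mul_le_mul_of_nonneg_left (hb n) (by positivity)
    have lim := (tendsto_pow_atTop_nhds_zero_of_lt_one (norm_nonneg (p : C)) h3).mul_const b
    rw [zero_mul] at lim
    exact absurd (ge_of_tendsto' lim key) (not_le.2 h1pos)

variable (P : AffinoidPerfectoid p C A)

/-- The structure map `O_C → A⁺`. -/
def structureMap : OC C →+* P.plus :=
  ((algebraMap C A).comp (OC C).subtype).codRestrict P.plus
    fun x => P.algebraMap_mem_plus x x.2

variable [CharZero C] [Fact (‖(p : C)‖ < 1)] [Nontrivial A]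

/-- The map `O_C^♭ → (A⁺)^♭`. -/
def tiltMap : PreTilt (OC C) p →+* PreTilt P.plus p :=
  Perfection.map p (Ideal.quotientMap (Ideal.span {(p : P.plus)}) P.structureMap
    (by
      rw [Ideal.span_singleton_le_iff_mem, Ideal.mem_comap, map_natCast]
      exact Ideal.mem_span_singleton_self _) :
    ModP (OC C) p →+* ModP P.plus p)

/-- `𝔸_inf(A⁺) = W((A⁺)^♭)`. -/
abbrev AAinf : Type v := WittVector p (PreTilt P.plus p)

/-- `𝔸_inf(A⁺)` is an `A_inf`-algebra by functoriality. -/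
instance : Algebra (Ainf p C) P.AAinf := (WittVector.map P.tiltMap).toAlgebra

end AffinoidPerfectoid

end AcrisInj

end

noncomputable section

namespace AcrisInj

/-! ### The exponents of `p` in the denominators -/

/-! Write `W` for `𝔸_inf(R')` and `B` for `A_inf`. The argument uses only that `W` is
`p`-torsion-free and `p`-adically complete, and that `ξ` is a nonzerodivisor on `W/p` for which
`W/p` is separated (`IsRegularSeparated`). For Witt vectors this reduces to the same two properties
of `ε - 1` in the tilt; they follow from the fact that a power of `ζ_{p^k} - 1` is `p` up to a unit.

As a `W`-module, `𝔸_cris^{0,(m)}` is spanned by `γ_n = ξ^n / p^{v(n)}`, where `v(n)` is the sum of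
`⌊n / p^j⌋` over the `j ≥ 1` with `p^j ≤ m`. All relations between the `γ_n` come from
`p^{v(n+1)-v(n)} γ_{n+1} = ξ γ_n` (`sum_smul_eq_zero_of_dpGamma`). The same relations hold over `B`,
so `W ⊗ A_cris^{0,(m)}` is `𝔸_cris^{0,(m)}` without any appeal to flatness. This gives `a`, and it
embeds `𝔸_cris^(m)` into the `(p, μ)`-adic completion of `X = 𝔸_cris^{0,(m)}`.

Modulo `ξ^n` the denominators in `X` are bounded, so the image of `X` in `W[1/p]/ξ^n` is
`p`-adically separated and complete. Since `ξ` divides `μ`, the completion of `X` therefore maps to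
every `W[1/p]/ξ^n`, hence to `𝔹_dR^+` (`DeRhamData.exists_deRham`). The heart of the proof is the
injectivity of this map (`DeRhamData.eq_zero_of_approx`). For `m ≥ p` the topology of `X` is the
`p`-adic one, and `p^k X` is `ξ`-adically closed in `X`. For `m < p` one has `X = W`, and `ξ^2 ∈ (p,
μ)` gives the claim.

The rest is formal. Composing `a` with this embedding gives the inclusion into `W[1/p] ⊆ 𝔹_dR^+`. By
density, composing `b` with `c` gives the embedding of `𝔸_cris^(m)`. Finally `μ = ([ε^{1/p}] - 1)
ξ`, where `[ε^{1/p}] - 1` divides `ξ - p`. Both `ξ` and `ξ - p` are nonzerodivisors of `𝔹_dR^+`, the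
latter because `p` is invertible and `𝔹_dR^+` is `ξ`-adically separated, so there is no `μ`-torsion
in `𝔹_dR^+` or in any ring embedded in it. -/

/-- The largest exponent `v` such that `ξ ^ n / p ^ v` is, up to a unit, a product of elements
`ξ ^ i / i!` with `i ≤ m`. -/
def dpVal (p : ℕ) (m : ℕ∞) (n : ℕ) : ℕ :=
  ∑ j ∈ Finset.range n, if ((p ^ (j + 1) : ℕ) : ℕ∞) ≤ m then n / p ^ (j + 1) else 0

section dpVal

variable {p : ℕ} {m : ℕ∞}

@[simp] theorem dpVal_zero : dpVal p m 0 = 0 := by simp [dpVal]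

theorem dpVal_eq_zero (hm : m < p) (n : ℕ) : dpVal p m n = 0 := by
  refine Finset.sum_eq_zero fun j _ => if_neg fun h => ?_
  have h1 : (p : ℕ∞) ≤ ((p ^ (j + 1) : ℕ) : ℕ∞) := by
    exact_mod_cast Nat.le_self_pow j.succ_ne_zero p
  exact absurd (h1.trans h) (not_le.2 hm)

variable [hp : Fact p.Prime]

theorem dpVal_eq_sum {n N : ℕ} (h : n ≤ N) :
    dpVal p m n =
      ∑ j ∈ Finset.range N, if ((p ^ (j + 1) : ℕ) : ℕ∞) ≤ m then n / p ^ (j + 1) else 0 := by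
  refine Finset.sum_subset (Finset.range_subset_range.2 h) fun j _ hj => ?_
  rw [Finset.mem_range, not_lt] at hj
  have : n < p ^ (j + 1) :=
    hj.trans_lt ((Nat.lt_succ_self j).trans (Nat.lt_pow_self hp.out.one_lt))
  simp [Nat.div_eq_of_lt this]

theorem dpVal_add_le (a b : ℕ) : dpVal p m a + dpVal p m b ≤ dpVal p m (a + b) := by
  rw [dpVal_eq_sum (Nat.le_add_right a b), dpVal_eq_sum (Nat.le_add_left b a), dpVal,
    ← Finset.sum_add_distrib]
  refine Finset.sum_le_sum fun j _ => ?_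
  split_ifs
  · exact Nat.div_add_div_le_add_div
  · exact le_rfl

theorem dpVal_mono : Monotone (dpVal p m) := fun a b h => by
  obtain ⟨c, rfl⟩ := Nat.exists_eq_add_of_le h
  exact (Nat.le_add_right _ _).trans (dpVal_add_le a c)

/-- The summand `⌊n / p⌋` occurs because `p ≤ m`, and it jumps at multiples of `p`. These jumps
supply the factors of `p` when `m ≥ p`. -/
theorem dpVal_lt_succ (hm : (p : ℕ∞) ≤ m) {n : ℕ} (h : p ∣ n + 1) :
    dpVal p m n < dpVal p m (n + 1) := by
  rw [dpVal_eq_sum n.le_succ, dpVal]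
  refine Finset.sum_lt_sum (fun j _ => ?_) ⟨0, by simp, ?_⟩
  · split_ifs
    · exact Nat.div_le_div_right n.le_succ
    · exact le_rfl
  · obtain ⟨c, hc⟩ := h
    have : n / p < c := Nat.div_lt_of_lt_mul (by omega)
    simpa [hm, hc, hp.out.pos] using this

/-- Legendre's formula: for `n ≤ m` the restriction `p^j ≤ m` only discards zero terms. -/
theorem dpVal_eq_padicValNat {n : ℕ} (h : (n : ℕ∞) ≤ m) :
    dpVal p m n = padicValNat p n.factorial := by
  rw [padicValNat_factorial (b := n + 1) (Nat.lt_succ_of_le (Nat.log_le_self p n)),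
    Finset.sum_Ico_eq_sum_range]
  refine Finset.sum_congr rfl fun j _ => ?_
  rw [add_comm 1 j]
  split_ifs with hj
  · rfl
  · refine (Nat.div_eq_of_lt ?_).symm
    by_contra hlt
    rw [not_lt] at hlt
    exact hj ((Nat.cast_le.2 hlt).trans h)

/-- Every `p`-power at most `M` divides the largest one, `q`, so no carries occur when `q` is added.
Hence `γ_{q+n} = γ_q γ_n`, which builds every `γ_n` from those with index at most `M`. -/
theorem dpVal_pow_log_add {M : ℕ} (n : ℕ) :
    dpVal p M (p ^ Nat.log p M + n) = dpVal p M (p ^ Nat.log p M) + dpVal p M n := by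
  rw [dpVal_eq_sum (Nat.le_add_right (p ^ Nat.log p M) n),
    dpVal_eq_sum (Nat.le_add_left n (p ^ Nat.log p M)), dpVal, ← Finset.sum_add_distrib]
  refine Finset.sum_congr rfl fun j _ => ?_
  split_ifs with hj
  · refine Nat.add_div_of_dvd_right (pow_dvd_pow p ?_)
    exact Nat.le_log_of_pow_le hp.out.one_lt (by exact_mod_cast hj)
  · rfl

end dpVal

/-! ### Regular and separated elements of `p`-adically complete rings -/

/-- `W` is `p`-torsion-free and `p`-adically complete, and `ξ` is a nonzerodivisor of `W / p` for
which `W / p` is `ξ`-adically separated. -/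
structure IsRegularSeparated (p : ℕ) {W : Type*} [CommRing W] (ξ : W) : Prop where
  eq_zero_of_mul : ∀ x : W, (p : W) * x = 0 → x = 0
  isAdicComplete : IsAdicComplete (Ideal.span {(p : W)}) W
  dvd_of_dvd_mul : ∀ x : W, (p : W) ∣ ξ * x → (p : W) ∣ x
  dvd_of_forall : ∀ x : W, (∀ n : ℕ, ∃ a b, x = p * a + ξ ^ n * b) → (p : W) ∣ x

theorem eq_zero_of_forall_pow_dvd {p : ℕ} {W : Type*} [CommRing W]
    [IsHausdorff (Ideal.span {(p : W)}) W] {x : W} (h : ∀ k, (p : W) ^ k ∣ x) : x = 0 :=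
  IsHausdorff.haus ‹_› x fun k => by
    rw [SModEq.zero, smul_eq_mul, Ideal.mul_top, Ideal.span_singleton_pow]
    exact Ideal.mem_span_singleton.2 (h k)

theorem exists_limit {p : ℕ} {W : Type*} [CommRing W]
    [IsPrecomplete (Ideal.span {(p : W)}) W] (w : ℕ → W) :
    ∃ s : W, ∀ k, (p : W) ^ k ∣ s - ∑ i ∈ Finset.range k, (p : W) ^ i * w i := by
  have key : ∀ {a b : ℕ}, a ≤ b → (p : W) ^ a ∣
      (∑ i ∈ Finset.range a, (p : W) ^ i * w i) - ∑ i ∈ Finset.range b, (p : W) ^ i * w i := by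
    intro a b h
    rw [← Finset.sum_range_add_sum_Ico _ h, sub_add_cancel_left, dvd_neg]
    exact Finset.dvd_sum fun i hi => Dvd.dvd.mul_right (pow_dvd_pow _ (Finset.mem_Ico.1 hi).1) _
  obtain ⟨s, hs⟩ := IsPrecomplete.prec (I := Ideal.span {(p : W)}) (M := W) ‹_›
    (f := fun k => ∑ i ∈ Finset.range k, (p : W) ^ i * w i) fun {a b} h => by
      rw [SModEq.sub_mem, smul_eq_mul, Ideal.mul_top, Ideal.span_singleton_pow]
      exact Ideal.mem_span_singleton.2 (key h)
  refine ⟨s, fun k => ?_⟩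
  have := hs k
  rw [SModEq.sub_mem, smul_eq_mul, Ideal.mul_top, Ideal.span_singleton_pow,
    Ideal.mem_span_singleton] at this
  rwa [← dvd_neg, neg_sub]

/-- Integers prime to `p` are units of `p`-adically complete rings. -/
theorem isUnit_natCast_of_coprime {p : ℕ} {W : Type*} [CommRing W]
    [IsAdicComplete (Ideal.span {(p : W)}) W] {u : ℕ} (h : Nat.Coprime u p) :
    IsUnit (u : W) := by
  have h1 : (p : W) ∈ (⊥ : Ideal W).jacobson :=
    IsAdicComplete.le_jacobson_bot _ (Ideal.mem_span_singleton_self _)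
  have h2 := Nat.isCoprime_iff_coprime.2 h
  obtain ⟨a, b, hab⟩ := h2
  have h3 : (a : W) * u + b * p = 1 := by exact_mod_cast congrArg (Int.cast : ℤ → W) hab
  have h4 : IsUnit ((p : W) * (-b) + 1) := Ideal.mem_jacobson_bot.1 h1 _
  have h5 : (p : W) * (-b) + 1 = u * a := by linear_combination -h3
  rw [h5] at h4
  exact isUnit_of_mul_isUnit_left h4

/-! ### Interplay of the `p`-adic and `ξ`-adic topologies on `W` -/

namespace IsRegularSeparated

variable {p : ℕ} {W : Type*} [CommRing W] {ξ : W} (h : IsRegularSeparated p ξ)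
include h

theorem pow_mul_cancel {k : ℕ} {x y : W} (e : (p : W) ^ k * x = (p : W) ^ k * y) : x = y := by
  induction k with
  | zero => simpa using e
  | succ k ih =>
    refine ih (sub_eq_zero.1 (h.eq_zero_of_mul _ ?_))
    linear_combination e

theorem pow_dvd_of_dvd_mul {k n : ℕ} {x : W} (e : (p : W) ^ k ∣ ξ ^ n * x) : (p : W) ^ k ∣ x := by
  have h1 : ∀ n x, (p : W) ∣ ξ ^ n * x → (p : W) ∣ x := fun n => by
    induction n with
    | zero => intro x hx; simpa using hx
    | succ n ih => intro x hx; exact ih x (h.dvd_of_dvd_mul _ (by rwa [← mul_assoc, ← pow_succ']))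
  induction k with
  | zero => simp
  | succ k ih =>
    obtain ⟨y, rfl⟩ := ih ((pow_dvd_pow _ k.le_succ).trans e)
    obtain ⟨z, hz⟩ := e
    have h2 : ξ ^ n * y = p * z := h.pow_mul_cancel (k := k) (by linear_combination hz)
    rw [pow_succ]
    exact mul_dvd_mul_left _ (h1 n y ⟨z, h2⟩)

theorem eq_zero_of_pow_mul {n : ℕ} {x : W} (e : ξ ^ n * x = 0) : x = 0 :=
  have := h.isAdicComplete
  eq_zero_of_forall_pow_dvd (p := p) fun _ => h.pow_dvd_of_dvd_mul (n := n) (by rw [e]; simp)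

theorem xi_pow_mul_cancel {n : ℕ} {x y : W} (e : ξ ^ n * x = ξ ^ n * y) : x = y :=
  sub_eq_zero.1 (h.eq_zero_of_pow_mul (n := n) (by rw [mul_sub, e, sub_self]))

theorem xi_pow_dvd_of_dvd_mul {k n : ℕ} {x : W} (e : ξ ^ n ∣ (p : W) ^ k * x) : ξ ^ n ∣ x := by
  obtain ⟨y, hy⟩ := e
  obtain ⟨z, rfl⟩ := h.pow_dvd_of_dvd_mul (n := n) ⟨x, hy.symm⟩
  exact ⟨z, h.pow_mul_cancel (k := k) (by linear_combination hy)⟩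

/-- `W/ξ^n` is `p`-adically separated: as `ξ` is regular modulo `p`, the cofactors `b k` form a
`p`-adic Cauchy sequence, and their limit is the quotient of `x` by `ξ^n`. -/
theorem xi_pow_dvd_of_forall {n : ℕ} {x : W}
    (e : ∀ k : ℕ, ∃ a b, x = (p : W) ^ k * a + ξ ^ n * b) : ξ ^ n ∣ x := by
  have := h.isAdicComplete
  choose a b hab using e
  have h1 : ∀ k, (p : W) ^ k ∣ b (k + 1) - b k := fun k =>
    h.pow_dvd_of_dvd_mul (n := n) ⟨a k - p * a (k + 1), by
      linear_combination hab k - hab (k + 1)⟩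
  choose w hw using h1
  obtain ⟨s, hs⟩ := exists_limit (p := p) w
  have h2 : ∀ k, ∑ i ∈ Finset.range k, (p : W) ^ i * w i = b k - b 0 := fun k => by
    rw [← Finset.sum_range_sub]
    exact Finset.sum_congr rfl fun i _ => (hw i).symm
  refine ⟨b 0 + s, sub_eq_zero.1 (eq_zero_of_forall_pow_dvd (p := p) fun k => ?_)⟩
  obtain ⟨c, hc⟩ := hs k
  exact ⟨a k - ξ ^ n * c, by linear_combination hab k - ξ ^ n * hc - ξ ^ n * h2 k⟩

/-- Separatedness of `W/p` yields a factor `p`. Dividing by it preserves divisibility by all `ξ^n`,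
so `x` is divisible by every power of `p`. -/
theorem eq_zero_of_forall_xi_pow_dvd {x : W} (e : ∀ n, ξ ^ n ∣ x) : x = 0 := by
  have := h.isAdicComplete
  refine eq_zero_of_forall_pow_dvd (p := p) fun k => ?_
  suffices ∃ y, x = (p : W) ^ k * y by exact this
  induction k with
  | zero => exact ⟨x, by simp⟩
  | succ k ih =>
    obtain ⟨y, rfl⟩ := ih
    obtain ⟨z, rfl⟩ := h.dvd_of_forall y fun n =>
      (h.xi_pow_dvd_of_dvd_mul (e n)).imp' (fun _ => 0) (fun b hb => ⟨b, by simpa using hb⟩)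
    exact ⟨z, by ring⟩

end IsRegularSeparated

/-! ### Generators of divided power subalgebras as modules -/

section Gamma

variable (p : ℕ) {W : Type*} [CommRing W] (ξ : W) (m : ℕ∞)

/-- The element `ξ ^ n / p ^ v` of `W[1/p]` for `v = dpVal p m n`. -/
def dpGamma (n : ℕ) : Localization.Away (p : W) :=
  algebraMap W _ ξ ^ n * IsLocalization.Away.invSelf (p : W) ^ dpVal p m n

theorem isUnit_natCast_away : IsUnit (p : Localization.Away (p : W)) := by
  simpa using IsLocalization.Away.algebraMap_isUnit (S := Localization.Away (p : W)) (p : W)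

variable {p} in
theorem pow_natCast_mul_cancel {k : ℕ} {x y : Localization.Away (p : W)}
    (h : (p : Localization.Away (p : W)) ^ k * x = (p : Localization.Away (p : W)) ^ k * y) :
    x = y :=
  ((isUnit_natCast_away p).pow k).mul_left_cancel h

theorem pow_natCast_smul (k : ℕ) (x : Localization.Away (p : W)) :
    (p : W) ^ k • x = (p : Localization.Away (p : W)) ^ k * x := by
  rw [Algebra.smul_def, map_pow, map_natCast]

theorem pow_mul_dpGamma (n : ℕ) :
    (p : Localization.Away (p : W)) ^ dpVal p m n * dpGamma p ξ m n = algebraMap W _ ξ ^ n := by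
  have : (p : Localization.Away (p : W)) * IsLocalization.Away.invSelf (p : W) = 1 := by
    simpa using IsLocalization.Away.mul_invSelf (S := Localization.Away (p : W)) (p : W)
  rw [dpGamma, mul_left_comm, ← mul_pow, this, one_pow, mul_one]

@[simp] theorem dpGamma_zero : dpGamma p ξ m 0 = 1 := by simp [dpGamma]

theorem xi_pow_dvd_dpGamma {n i : ℕ} (h : n ≤ i) :
    algebraMap W (Localization.Away (p : W)) ξ ^ n ∣ dpGamma p ξ m i :=
  (pow_dvd_pow _ h).trans (Dvd.intro _ rfl)

variable [hp : Fact p.Prime]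

theorem dpGamma_mul (a b : ℕ) :
    dpGamma p ξ m a * dpGamma p ξ m b =
      (p : W) ^ (dpVal p m (a + b) - (dpVal p m a + dpVal p m b)) • dpGamma p ξ m (a + b) := by
  obtain ⟨c, hc⟩ := Nat.exists_eq_add_of_le (dpVal_add_le (p := p) (m := m) a b)
  rw [pow_natCast_smul]
  refine pow_natCast_mul_cancel (k := dpVal p m a + dpVal p m b) ?_
  have h1 := pow_mul_dpGamma p ξ m (a + b)
  rw [hc] at h1 ⊢
  rw [Nat.add_sub_cancel_left, ← mul_assoc (_ ^ _) (_ ^ c), ← pow_add, h1, pow_add,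
    mul_mul_mul_comm, pow_mul_dpGamma, pow_mul_dpGamma, pow_add]

theorem dpGamma_add {a b : ℕ} (h : dpVal p m (a + b) = dpVal p m a + dpVal p m b) :
    dpGamma p ξ m (a + b) = dpGamma p ξ m a * dpGamma p ξ m b := by
  rw [dpGamma_mul, h, Nat.sub_self, pow_zero, one_smul]

theorem pow_smul_dpGamma_succ (n : ℕ) :
    (p : W) ^ (dpVal p m (n + 1) - dpVal p m n) • dpGamma p ξ m (n + 1) =
      ξ • dpGamma p ξ m n := by
  obtain ⟨c, hc⟩ := Nat.exists_eq_add_of_le (dpVal_mono (p := p) (m := m) n.le_succ)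
  rw [pow_natCast_smul]
  refine pow_natCast_mul_cancel (k := dpVal p m n) ?_
  have h1 := pow_mul_dpGamma p ξ m (n + 1)
  rw [Nat.succ_eq_add_one] at hc
  rw [hc] at h1 ⊢
  rw [Nat.add_sub_cancel_left, ← mul_assoc, ← pow_add, h1, Algebra.smul_def, mul_left_comm,
    pow_mul_dpGamma, pow_succ']

variable [IsAdicComplete (Ideal.span {(p : W)}) W]

variable (W) in
theorem exists_factorial_eq (n : ℕ) :
    ∃ u : Wˣ, (n.factorial : W) = u * (p : W) ^ padicValNat p n.factorial := by
  obtain ⟨u, hu⟩ := (pow_padicValNat_dvd (p := p) (n := n.factorial))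
  have hcop : u.Coprime p := by
    refine ((Nat.Prime.coprime_iff_not_dvd hp.out).2 fun ⟨c, hc⟩ => ?_).symm
    refine pow_succ_padicValNat_not_dvd (p := p) n.factorial_ne_zero ⟨c, ?_⟩
    rw [pow_succ, mul_assoc, ← hc, ← hu]
  obtain ⟨v, hv⟩ := isUnit_natCast_of_coprime (W := W) hcop
  refine ⟨v, ?_⟩
  rw [hv, mul_comm]
  exact_mod_cast congrArg (Nat.cast : ℕ → W) hu

theorem dpGamma_mem_of_le {n : ℕ} (h : (n : ℕ∞) ≤ m) : dpGamma p ξ m n ∈ dpSub p W ξ m := by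
  rcases Nat.eq_zero_or_pos n with rfl | hn
  · rw [dpGamma_zero]; exact one_mem _
  obtain ⟨u, hu⟩ := exists_factorial_eq (p := p) W n
  have h1 : (↑u⁻¹ : W) • dpGamma p ξ m n ∈ dpSub p W ξ m := by
    refine Algebra.subset_adjoin ⟨n, hn, h, ?_⟩
    have h2 := congrArg (algebraMap W (Localization.Away (p : W))) hu
    rw [map_natCast, map_mul, map_pow, map_natCast] at h2
    rw [h2, Algebra.smul_def, ← pow_mul_dpGamma p ξ m n, dpVal_eq_padicValNat h,
      mul_mul_mul_comm, ← map_mul, Units.mul_inv, map_one, one_mul]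
  simpa [smul_smul] using Subalgebra.smul_mem _ h1 (u : W)

/-- For finite `m`, split off copies of `γ_q`, with `q` the largest `p`-power at most `m`, until the
index is at most `m`; there `n!` is a unit times `p^{v(n)}`. -/
theorem dpGamma_mem (hm : 1 ≤ m) (n : ℕ) : dpGamma p ξ m n ∈ dpSub p W ξ m := by
  induction m using ENat.recTopCoe with
  | top => exact dpGamma_mem_of_le p ξ ⊤ le_top
  | coe M =>
    have hM : 1 ≤ M := by exact_mod_cast hm
    induction n using Nat.strong_induction_on with
    | _ n ih =>
      have hle : p ^ Nat.log p M ≤ M := Nat.pow_log_le_self p (by omega)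
      by_cases hn : n ≤ M
      · exact dpGamma_mem_of_le p ξ M (by exact_mod_cast hn)
      · have hpos : 0 < p ^ Nat.log p M := pow_pos hp.out.pos _
        obtain ⟨c, rfl⟩ := Nat.exists_eq_add_of_le (hle.trans (not_le.1 hn).le)
        rw [dpGamma_add p ξ M (dpVal_pow_log_add c)]
        exact mul_mem (dpGamma_mem_of_le p ξ M (by exact_mod_cast hle)) (ih c (by omega))

theorem exists_eq_sum_of_mem_dpSub {x : Localization.Away (p : W)} (hx : x ∈ dpSub p W ξ m) :
    ∃ (N : ℕ) (w : ℕ → W), ∀ n, N ≤ n →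
      x = ∑ i ∈ Finset.range n, w i • dpGamma p ξ m i := by
  have h1 : x ∈ Submodule.span W (Set.range (dpGamma p ξ m)) := by
    rw [dpSub, ← Subalgebra.mem_toSubmodule, Algebra.adjoin_eq_span] at hx
    refine (Submodule.span_le.2 fun y hy => ?_) hx
    suffices ∃ (w : W) (n : ℕ), y = w • dpGamma p ξ m n by
      obtain ⟨w, n, rfl⟩ := this
      exact Submodule.smul_mem _ _ (Submodule.subset_span ⟨n, rfl⟩)
    induction hy using Submonoid.closure_induction with
    | mem y hy =>
      obtain ⟨n, -, hn, e⟩ := hy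
      obtain ⟨u, hu⟩ := exists_factorial_eq (p := p) W n
      refine ⟨(↑u⁻¹ : W), n, pow_natCast_mul_cancel (k := dpVal p m n) ?_⟩
      have h2 := congrArg (algebraMap W (Localization.Away (p : W))) hu
      rw [map_natCast, map_mul, map_pow, map_natCast] at h2
      rw [h2, ← dpVal_eq_padicValNat hn] at e
      rw [Algebra.smul_def, mul_left_comm, pow_mul_dpGamma, ← e, mul_assoc, ← mul_assoc, ← map_mul,
        Units.inv_mul, map_one, one_mul]
    | one => exact ⟨1, 0, by simp⟩
    | mul y z _ _ hy hz =>
      obtain ⟨w, n, rfl⟩ := hy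
      obtain ⟨w', n', rfl⟩ := hz
      exact ⟨_, n + n', by rw [smul_mul_smul_comm, dpGamma_mul, smul_smul]⟩
  rw [Finsupp.mem_span_range_iff_exists_finsupp] at h1
  obtain ⟨c, rfl⟩ := h1
  refine ⟨c.support.sup id + 1, c, fun n hn =>
    Finset.sum_subset (fun i hi => ?_) fun i _ hi => ?_⟩
  · exact Finset.mem_range.2 ((Nat.lt_succ_of_le (Finset.le_sup (f := id) hi)).trans_le hn)
  · simp [Finsupp.notMem_support_iff.1 hi]

theorem exists_approx {x : Localization.Away (p : W)} (hx : x ∈ dpSub p W ξ m) (n : ℕ) :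
    ∃ w : ℕ → W, algebraMap W (Localization.Away (p : W)) ξ ^ n ∣
      x - ∑ i ∈ Finset.range n, w i • dpGamma p ξ m i := by
  obtain ⟨N, w, hw⟩ := exists_eq_sum_of_mem_dpSub p ξ m hx
  refine ⟨w, ?_⟩
  rw [hw (n + N) (Nat.le_add_left _ _), ← Finset.sum_range_add_sum_Ico _ (Nat.le_add_right n N),
    add_sub_cancel_left]
  refine Finset.dvd_sum fun i hi => ?_
  rw [Algebra.smul_def]
  exact Dvd.dvd.mul_left (xi_pow_dvd_dpGamma p ξ m (Finset.mem_Ico.1 hi).1) _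

/-- Modulo `ξ ^ n`, the denominators of the elements of `dpSub p W ξ m` are bounded. -/
theorem exists_pow_mul_approx {x : Localization.Away (p : W)} (hx : x ∈ dpSub p W ξ m) (n : ℕ) :
    ∃ w : W, algebraMap W (Localization.Away (p : W)) ξ ^ n ∣
      (p : Localization.Away (p : W)) ^ dpVal p m n * x - algebraMap W _ w := by
  obtain ⟨w, hw⟩ := exists_approx p ξ m hx n
  refine ⟨∑ i ∈ Finset.range n, w i * (p ^ (dpVal p m n - dpVal p m i) * ξ ^ i), ?_⟩
  convert Dvd.dvd.mul_left hw ((p : Localization.Away (p : W)) ^ dpVal p m n) using 1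
  rw [mul_sub, Finset.mul_sum, map_sum]
  refine congrArg _ (Finset.sum_congr rfl fun i hi => ?_)
  obtain ⟨c, hc⟩ := Nat.exists_eq_add_of_le'
    (dpVal_mono (p := p) (m := m) (Finset.mem_range.1 hi).le)
  rw [hc, Nat.add_sub_cancel, Algebra.smul_def, map_mul, map_mul, map_pow, map_pow, map_natCast,
    pow_add, ← pow_mul_dpGamma p ξ m i]
  ring

/-- Modulo `ξ ^ n`, the algebra `dpSub p W ξ m` is `p`-adically precomplete. -/
theorem exists_limit_dpSub (hm : 1 ≤ m) (n : ℕ) {u : ℕ → Localization.Away (p : W)}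
    (hu : ∀ j, u j ∈ dpSub p W ξ m) :
    ∃ s ∈ dpSub p W ξ m, ∀ k, ∃ t ∈ dpSub p W ξ m,
      algebraMap W (Localization.Away (p : W)) ξ ^ n ∣
        s - ∑ j ∈ Finset.range k, (p : Localization.Away (p : W)) ^ j * u j -
          (p : Localization.Away (p : W)) ^ k * t := by
  choose w hw using fun j => exists_approx p ξ m (hu j) n
  -- Modulo `ξ^n` only the first `n` generators matter, so the series is summed coefficient by
  -- coefficient in `W`.
  choose s hs using fun i => exists_limit (p := p) fun j => w j i
  choose r hr using hs
  refine ⟨∑ i ∈ Finset.range n, s i • dpGamma p ξ m i,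
    sum_mem fun i _ => Subalgebra.smul_mem _ (dpGamma_mem p ξ m hm i) _, fun k =>
    ⟨∑ i ∈ Finset.range n, r i k • dpGamma p ξ m i,
      sum_mem fun i _ => Subalgebra.smul_mem _ (dpGamma_mem p ξ m hm i) _, ?_⟩⟩
  have h1 : algebraMap W (Localization.Away (p : W)) ξ ^ n ∣
      -∑ j ∈ Finset.range k, (p : Localization.Away (p : W)) ^ j *
        (u j - ∑ i ∈ Finset.range n, w j i • dpGamma p ξ m i) :=
    (Finset.dvd_sum fun j _ => Dvd.dvd.mul_left (hw j) _).neg_right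
  convert h1 using 1
  have h2 : ∀ i, s i • dpGamma p ξ m i =
      (∑ j ∈ Finset.range k, (p : Localization.Away (p : W)) ^ j * w j i • dpGamma p ξ m i) +
        (p : Localization.Away (p : W)) ^ k * r i k • dpGamma p ξ m i := fun i => by
    rw [sub_eq_iff_eq_add'.1 (hr i k), add_smul, Finset.sum_smul]
    simp only [mul_smul, pow_natCast_smul]
  simp only [h2, Finset.sum_add_distrib, mul_sub, Finset.sum_sub_distrib, Finset.mul_sum]
  rw [Finset.sum_comm]
  ring

end Gamma

/-! ### The `ξ`-adic filtration of `W[1/p]` and its divided power subalgebras -/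

namespace IsRegularSeparated

variable {p : ℕ} [hp : Fact p.Prime] {W : Type*} [CommRing W] {ξ : W}
  (h : IsRegularSeparated p ξ)

omit hp

theorem exists_pow_mul_eq (x : Localization.Away (p : W)) :
    ∃ (k : ℕ) (w : W), (p : Localization.Away (p : W)) ^ k * x = algebraMap W _ w := by
  obtain ⟨k, w, e⟩ := IsLocalization.Away.surj (p : W) x
  exact ⟨k, w, by rw [mul_comm, ← e, map_natCast]⟩

include h

theorem algebraMap_injective : Function.Injective (algebraMap W (Localization.Away (p : W))) :=
  IsLocalization.injective _ (Submonoid.powers_le.2 (mem_nonZeroDivisors_iff_left.2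
    fun x hx => h.eq_zero_of_mul x hx))

theorem xi_pow_dvd_of_algebraMap {n : ℕ} {w : W}
    (e : algebraMap W (Localization.Away (p : W)) ξ ^ n ∣ algebraMap W _ w) : ξ ^ n ∣ w := by
  obtain ⟨x, hx⟩ := e
  obtain ⟨k, y, hy⟩ := exists_pow_mul_eq x
  refine h.xi_pow_dvd_of_dvd_mul (k := k) ⟨y, h.algebraMap_injective ?_⟩
  rw [map_mul, map_mul, map_pow, map_pow, map_natCast, hx, ← hy]
  ring

theorem xi_pow_mul_cancel' {n : ℕ} {x y : Localization.Away (p : W)}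
    (e : algebraMap W _ ξ ^ n * x = algebraMap W _ ξ ^ n * y) : x = y := by
  refine sub_eq_zero.1 ?_
  obtain ⟨k, w, hw⟩ := exists_pow_mul_eq (x - y)
  have h1 : ξ ^ n * w = 0 := h.algebraMap_injective (by
    rw [map_mul, ← hw, map_pow, map_zero]; linear_combination (p : Localization.Away (p : W)) ^ k * e)
  rw [h.eq_zero_of_pow_mul h1, map_zero] at hw
  exact pow_natCast_mul_cancel (k := k) (by rw [hw, mul_zero])

theorem eq_zero_of_forall_xi_pow_dvd' {x : Localization.Away (p : W)}
    (e : ∀ n, algebraMap W (Localization.Away (p : W)) ξ ^ n ∣ x) : x = 0 := by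
  obtain ⟨k, w, hw⟩ := exists_pow_mul_eq x
  have h1 : w = 0 := h.eq_zero_of_forall_xi_pow_dvd fun n =>
    h.xi_pow_dvd_of_algebraMap (by rw [← hw]; exact Dvd.dvd.mul_left (e n) _)
  rw [h1, map_zero] at hw
  exact pow_natCast_mul_cancel (k := k) (by rw [hw, mul_zero])

include hp

/-- A combination of the first `n` generators that is divisible by `ξ ^ n` is a multiple of
`ξ` times the last one. -/
theorem exists_eq_smul_dpGamma (m : ℕ∞) {n : ℕ} {w : ℕ → W}
    (e : algebraMap W (Localization.Away (p : W)) ξ ^ n ∣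
      ∑ i ∈ Finset.range n, w i • dpGamma p ξ m i) :
    ∃ b : W, ∑ i ∈ Finset.range n, w i • dpGamma p ξ m i =
      b • (p : W) ^ (dpVal p m n - dpVal p m (n - 1)) • dpGamma p ξ m n := by
  induction n with
  | zero => exact ⟨0, by simp⟩
  | succ n ih =>
    rw [Finset.sum_range_succ] at e ⊢
    have h1 : algebraMap W (Localization.Away (p : W)) ξ ^ n ∣ w n • dpGamma p ξ m n := by
      rw [Algebra.smul_def]; exact Dvd.dvd.mul_left (xi_pow_dvd_dpGamma p ξ m le_rfl) _
    obtain ⟨b, hb⟩ := ih ((dvd_add_left h1).1 ((pow_dvd_pow _ n.le_succ).trans e))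
    rw [hb, smul_smul, ← add_smul] at e ⊢
    set c := b * (p : W) ^ (dpVal p m n - dpVal p m (n - 1)) + w n with hc
    have h2 : ξ ^ (n + 1) ∣ ξ ^ n * c := by
      refine h.xi_pow_dvd_of_algebraMap ?_
      rw [map_mul, map_pow, ← pow_mul_dpGamma p ξ m n, mul_assoc, mul_comm (dpGamma p ξ m n),
        ← Algebra.smul_def]
      exact Dvd.dvd.mul_left e _
    obtain ⟨d, hd⟩ := h2
    -- The sum has collapsed to `c γ_n`. Divisibility by `ξ^(n+1)` forces `ξ ∣ c`, and `ξ γ_n` is a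
    -- power of `p` times `γ_{n+1}`.
    have h3 : c = ξ * d := h.xi_pow_mul_cancel (n := n) (by rw [hd]; ring)
    refine ⟨d, ?_⟩
    rw [h3, Nat.add_sub_cancel, pow_smul_dpGamma_succ, smul_smul, mul_comm]

/-- If `m ≥ p`, then `p ^ k A_cris^{0,(m)}` is closed for the `ξ`-adic topology. -/
theorem exists_eq_pow_mul_of_forall {m : ℕ∞} (hm : (p : ℕ∞) ≤ m) {k : ℕ}
    {x : Localization.Away (p : W)} (hx : x ∈ dpSub p W ξ m)
    (e : ∀ n : ℕ, ∃ z ∈ dpSub p W ξ m, algebraMap W (Localization.Away (p : W)) ξ ^ n ∣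
      x - (p : Localization.Away (p : W)) ^ k * z) :
    ∃ z ∈ dpSub p W ξ m, x = (p : Localization.Away (p : W)) ^ k * z := by
  have := h.isAdicComplete
  have hm1 : 1 ≤ m := le_trans (by exact_mod_cast hp.out.one_lt.le) hm
  induction k with
  | zero => exact ⟨x, hx, by simp⟩
  | succ k ih =>
    obtain ⟨x', hx', rfl⟩ := ih fun n => by
      obtain ⟨z, hz, hd⟩ := e n
      exact ⟨p * z, mul_mem (natCast_mem _ p) hz, by rwa [pow_succ, mul_assoc] at hd⟩
    obtain ⟨N, w, hw⟩ := exists_eq_sum_of_mem_dpSub p ξ m hx'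
    -- The cutoff is past all terms of `x'` and at a multiple of `p`, so that `v` jumps there and
    -- the error term gains a factor `p`.
    obtain ⟨n, hNn, hpn⟩ : ∃ n, N ≤ n + 1 ∧ p ∣ n + 1 := by
      refine ⟨p * (N + 1) - 1, ?_, ?_⟩
      all_goals rw [Nat.sub_add_cancel (Nat.mul_pos hp.out.pos N.succ_pos)]
      · nlinarith [hp.out.pos]
      · exact dvd_mul_right _ _
    obtain ⟨z, hz, a, ha⟩ := e (n + 1)
    have hd : algebraMap W (Localization.Away (p : W)) ξ ^ (n + 1) ∣ x' - p * z := by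
      obtain ⟨b, hb⟩ := ((isUnit_natCast_away (W := W) p).pow k).exists_right_inv
      refine ⟨b * a, ?_⟩
      linear_combination b * ha - (x' - p * z) * hb
    -- Truncating `z` as well makes `x' - p z`, modulo `ξ^(n+1)`, a combination of the first `n + 1`
    -- generators, hence a multiple of `p γ_{n+1}`.
    obtain ⟨y, hy⟩ := exists_approx p ξ m hz (n + 1)
    have hsum : ∑ i ∈ Finset.range (n + 1), (w i - p * y i) • dpGamma p ξ m i =
        x' - p * ∑ i ∈ Finset.range (n + 1), y i • dpGamma p ξ m i := by
      rw [hw _ hNn, Finset.mul_sum, ← Finset.sum_sub_distrib]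
      refine Finset.sum_congr rfl fun i _ => ?_
      rw [sub_smul, mul_smul, Algebra.smul_def (p : W), map_natCast]
    obtain ⟨b, hb⟩ := h.exists_eq_smul_dpGamma m (n := n + 1) (w := fun i => w i - p * y i) (by
      rw [hsum]
      convert dvd_add hd (Dvd.dvd.mul_left hy (p : Localization.Away (p : W))) using 1
      ring)
    obtain ⟨d, hd⟩ := Nat.exists_eq_add_of_lt (dpVal_lt_succ hm hpn)
    rw [hsum, Nat.add_sub_cancel, hd, show dpVal p m n + d + 1 - dpVal p m n = d + 1 by omega,
      pow_natCast_smul, sub_eq_iff_eq_add] at hb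
    refine ⟨(b • (p : W) ^ d • dpGamma p ξ m (n + 1)) +
      ∑ i ∈ Finset.range (n + 1), y i • dpGamma p ξ m i, add_mem (Subalgebra.smul_mem _
        (Subalgebra.smul_mem _ (dpGamma_mem p ξ m hm1 _) _) _)
      (sum_mem fun i _ => Subalgebra.smul_mem _ (dpGamma_mem p ξ m hm1 i) _), ?_⟩
    rw [hb, pow_natCast_smul, Algebra.smul_def, Algebra.smul_def]
    ring

/-- Modulo `ξ^n` the subalgebra lies in `p^{-v(n)} W`, so this reduces to the `p`-adic separatedness
of `W/ξ^n`. -/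
theorem xi_pow_dvd_of_forall_dpSub (m : ℕ∞) {n : ℕ} {x : Localization.Away (p : W)}
    (e : ∀ k : ℕ, ∃ z ∈ dpSub p W ξ m, algebraMap W (Localization.Away (p : W)) ξ ^ n ∣
      x - (p : Localization.Away (p : W)) ^ k * z) :
    algebraMap W (Localization.Away (p : W)) ξ ^ n ∣ x := by
  have := h.isAdicComplete
  set v := dpVal p m n
  choose z hz hd using e
  choose w hw using fun k => exists_pow_mul_approx p ξ m (hz k) n
  have h1 : ∀ k, algebraMap W (Localization.Away (p : W)) ξ ^ n ∣
      (p : Localization.Away (p : W)) ^ v * x - algebraMap W _ ((p : W) ^ k * w k) := fun k => by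
    convert dvd_add (Dvd.dvd.mul_left (hd k) ((p : Localization.Away (p : W)) ^ v))
      (Dvd.dvd.mul_left (hw k) ((p : Localization.Away (p : W)) ^ k)) using 1
    rw [map_mul, map_pow, map_natCast]
    ring
  have h2 : ξ ^ n ∣ w 0 := h.xi_pow_dvd_of_forall fun k => by
    obtain ⟨b, hb⟩ := h.xi_pow_dvd_of_algebraMap (n := n) (w := w 0 - p ^ k * w k) (by
      convert dvd_sub (h1 k) (h1 0) using 1
      rw [map_sub, pow_zero, one_mul]
      ring)
    exact ⟨w k, b, by linear_combination hb⟩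
  have h3 : algebraMap W (Localization.Away (p : W)) ξ ^ n ∣ algebraMap W _ (w 0) := by
    rw [← map_pow]; exact map_dvd _ h2
  have h4 := h1 0
  rw [pow_zero, one_mul] at h4
  exact (((isUnit_natCast_away (W := W) p).pow v).dvd_mul_left).1 ((dvd_sub_left h3).1 h4)

/-- Below `p` the exponents `v(n)` all vanish: no denominators appear and the subalgebra is `W`. -/
theorem exists_algebraMap_eq_of_lt {m : ℕ∞} (hm : m < p) {x : Localization.Away (p : W)}
    (hx : x ∈ dpSub p W ξ m) : ∃ w : W, algebraMap W _ w = x := by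
  have := h.isAdicComplete
  obtain ⟨N, w, hw⟩ := exists_eq_sum_of_mem_dpSub p ξ m hx
  refine ⟨∑ i ∈ Finset.range N, w i * ξ ^ i, ?_⟩
  rw [hw N le_rfl, map_sum]
  refine Finset.sum_congr rfl fun i _ => ?_
  rw [map_mul, map_pow, ← pow_mul_dpGamma p ξ m i, dpVal_eq_zero hm, pow_zero, one_mul,
    Algebra.smul_def]

end IsRegularSeparated

/-! ### Elements of adic completions -/

section Completion

variable {S : Type*} [CommRing S] {I : Ideal S}

theorem evalₐ_eq_mk_of_le {m n : ℕ} (hle : m ≤ n) {y : AdicCompletion I S} {z : S}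
    (h : AdicCompletion.evalₐ I n y = Ideal.Quotient.mk (I ^ n) z) :
    AdicCompletion.evalₐ I m y = Ideal.Quotient.mk (I ^ m) z := by
  obtain ⟨x, rfl⟩ := AdicCompletion.mk_surjective I S y
  rw [AdicCompletion.evalₐ_mk] at h ⊢
  rw [← AdicCompletion.Ideal.mk_eq_mk I hle x, Ideal.Quotient.eq]
  exact Ideal.pow_le_pow_right hle (Ideal.Quotient.eq.1 h)

theorem exists_evalₐ_eq_mk (n : ℕ) (y : AdicCompletion I S) :
    ∃ z : S, AdicCompletion.evalₐ I n y = Ideal.Quotient.mk (I ^ n) z :=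
  (Ideal.Quotient.mk_surjective _).imp fun _ => Eq.symm

/-- Finite generation of `I` is what makes the kernel of the projection to `S / I^n` equal to the
extension of `I^n`. -/
theorem mem_map_pow_of_evalₐ_eq_zero (hI : I.FG) {n : ℕ} {y : AdicCompletion I S}
    (h : AdicCompletion.evalₐ I n y = 0) :
    y ∈ I.map (algebraMap S (AdicCompletion I S)) ^ n := by
  have e : (I ^ n • ⊤ : Ideal S) = I ^ n := by rw [smul_eq_mul, Ideal.mul_top]
  have h1 : y ∈ (AdicCompletion.eval I S n).ker :=
    LinearMap.mem_ker.2 ((Ideal.quotientEquivAlgOfEq S e).injective (h.trans (map_zero _).symm))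
  rw [← AdicCompletion.pow_smul_top_eq_ker_eval hI, Ideal.smul_top_eq_map,
    Submodule.restrictScalars_mem] at h1
  rwa [← Ideal.map_pow]

end Completion

/-! ### The map to `𝔹_dR^+` -/

theorem span_pair_pow_le {X : Type*} [CommRing X] (a b : X) (k n : ℕ) :
    Ideal.span {a, b} ^ (k + n) ≤ Ideal.span {a ^ k, b ^ n} := by
  rw [Ideal.span_insert, Ideal.span_insert, ← Ideal.span_singleton_pow, ← Ideal.span_singleton_pow]
  exact Ideal.sup_pow_add_le_pow_sup_pow

/-- A presentation of `A_cris^{0,(m)}` as a ring `X` that embeds into `W[1/p]`, with the ideal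
`(p, μ)` of `X`. -/
structure DeRhamData (p : ℕ) {W : Type*} [CommRing W] (ξ μ : W) (m : ℕ∞) {X : Type*} [CommRing X]
    [Algebra W X] (ι : X →ₐ[W] Localization.Away (p : W)) (I : Ideal X) : Prop where
  regular : IsRegularSeparated p ξ
  one_le : 1 ≤ m
  injective : Function.Injective ι
  range_eq : ι.range = dpSub p W ξ m
  ideal_eq : I = Ideal.span {(p : X), algebraMap W X μ}
  xi_dvd : ξ ∣ μ
  xi_sq_mem : ξ ^ 2 ∈ Ideal.span {(p : W), μ}

namespace DeRhamData

variable {p : ℕ} {W : Type*} [CommRing W] {ξ μ : W} {m : ℕ∞} {X : Type*}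
  [CommRing X] [Algebra W X] {ι : X →ₐ[W] Localization.Away (p : W)} {I : Ideal X}

/-- The element `x` of `X` has the same image modulo `ξ ^ n` as the element `y` of the completion
of `X`. -/
def Approx (ι : X →ₐ[W] Localization.Away (p : W)) (I : Ideal X) (ξ : W) (n : ℕ)
    (y : AdicCompletion I X) (x : X) : Prop :=
  ∀ k : ℕ, ∃ z t : X, AdicCompletion.evalₐ I (k + n) y = Ideal.Quotient.mk _ z ∧
    algebraMap W _ ξ ^ n ∣ ι x - ι z - (p : Localization.Away (p : W)) ^ k * ι t

theorem approx_algebraMap (n : ℕ) (x : X) : Approx ι I ξ n (algebraMap X _ x) x :=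
  fun k => ⟨x, 0, by rw [AdicCompletion.algebraMap_apply, AdicCompletion.evalₐ_of]; rfl, by simp⟩

theorem Approx.add {n : ℕ} {y y' : AdicCompletion I X} {x x' : X} (h : Approx ι I ξ n y x)
    (h' : Approx ι I ξ n y' x') : Approx ι I ξ n (y + y') (x + x') := fun k => by
  obtain ⟨z, t, hz, ht⟩ := h k
  obtain ⟨z', t', hz', ht'⟩ := h' k
  refine ⟨z + z', t + t', by rw [map_add, hz, hz', map_add], ?_⟩
  convert dvd_add ht ht' using 1
  simp only [map_add]
  ring

theorem Approx.mul {n : ℕ} {y y' : AdicCompletion I X} {x x' : X} (h : Approx ι I ξ n y x)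
    (h' : Approx ι I ξ n y' x') : Approx ι I ξ n (y * y') (x * x') := fun k => by
  obtain ⟨z, t, hz, ht⟩ := h k
  obtain ⟨z', t', hz', ht'⟩ := h' k
  refine ⟨z * z', x * t' + z' * t, by rw [map_mul, hz, hz', map_mul], ?_⟩
  convert dvd_add (ht.mul_left (ι z')) (ht'.mul_left (ι x)) using 1
  simp only [map_add, map_mul]
  ring

theorem Approx.mono {n n' : ℕ} (hle : n ≤ n') {y : AdicCompletion I X} {x : X}
    (h : Approx ι I ξ n' y x) : Approx ι I ξ n y x := fun k => by
  obtain ⟨z, t, hz, ht⟩ := h k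
  exact ⟨z, t, evalₐ_eq_mk_of_le (Nat.add_le_add_left hle k) hz, (pow_dvd_pow _ hle).trans ht⟩

theorem Approx.of_dvd {n : ℕ} {y : AdicCompletion I X} {x x' : X} (h : Approx ι I ξ n y x)
    (hd : algebraMap W (Localization.Away (p : W)) ξ ^ n ∣ ι x' - ι x) :
    Approx ι I ξ n y x' := fun k => by
  obtain ⟨z, t, hz, ht⟩ := h k
  refine ⟨z, t, hz, ?_⟩
  convert dvd_add hd ht using 1
  ring

variable (H : DeRhamData p ξ μ m ι I)
include H

/-- Since `(p, μ)^(k+n) ⊆ (p^k, μ^n)` and `ξ^n ∣ μ^n`, the class at level `k + n` fixes the image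
modulo `ξ^n` up to `p^k X`. This is the reason for the index `k + n` in `Approx`. -/
theorem exists_of_mem_pow {k n : ℕ} {z : X} (hz : z ∈ I ^ (k + n)) :
    ∃ t : X, algebraMap W _ ξ ^ n ∣ ι z - (p : Localization.Away (p : W)) ^ k * ι t := by
  rw [H.ideal_eq] at hz
  obtain ⟨t, s, rfl⟩ := Ideal.mem_span_pair.1 (span_pair_pow_le _ _ k n hz)
  refine ⟨t, ?_⟩
  obtain ⟨c, hc⟩ := H.xi_dvd
  refine ⟨algebraMap W _ c ^ n * ι s, ?_⟩
  rw [map_add, map_mul, map_mul, map_pow, map_pow, map_natCast, AlgHom.commutes, hc, map_mul]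
  ring

theorem mem_dpSub (x : X) : ι x ∈ dpSub p W ξ m := by
  rw [← H.range_eq]
  exact ⟨x, rfl⟩

theorem exists_of_mem_dpSub {x : Localization.Away (p : W)} (hx : x ∈ dpSub p W ξ m) :
    ∃ z : X, ι z = x := by
  rwa [← H.range_eq] at hx

variable [hp : Fact p.Prime]

theorem dvd_of_approx {n : ℕ} {y : AdicCompletion I X} {x x' : X} (h : Approx ι I ξ n y x)
    (h' : Approx ι I ξ n y x') :
    algebraMap W (Localization.Away (p : W)) ξ ^ n ∣ ι x - ι x' := by
  refine H.regular.xi_pow_dvd_of_forall_dpSub m fun k => ?_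
  obtain ⟨z, t, hz, ht⟩ := h k
  obtain ⟨z', t', hz', ht'⟩ := h' k
  obtain ⟨s, hs⟩ := H.exists_of_mem_pow (Ideal.Quotient.eq.1 (hz.symm.trans hz'))
  refine ⟨ι (t - t' + s), H.mem_dpSub _, ?_⟩
  convert dvd_add (dvd_sub ht ht') hs using 1
  simp only [map_add, map_sub]
  ring

theorem exists_approx (n : ℕ) (y : AdicCompletion I X) : ∃ x, Approx ι I ξ n y x := by
  have := H.regular.isAdicComplete
  -- The differences of successive representatives are `p^k u_k` modulo `ξ^n`; the resulting series
  -- converges in `X` modulo `ξ^n`, and `z 0` plus its sum is the approximation.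
  choose z hz using fun k => exists_evalₐ_eq_mk (k + n) y
  have h1 : ∀ k, ∃ t : X, algebraMap W _ ξ ^ n ∣
      ι (z (k + 1) - z k) - (p : Localization.Away (p : W)) ^ k * ι t := fun k =>
    H.exists_of_mem_pow (Ideal.Quotient.eq.1
      ((evalₐ_eq_mk_of_le (by omega) (hz (k + 1))).symm.trans (hz k)))
  choose u hu using h1
  obtain ⟨s, hs, hlim⟩ := exists_limit_dpSub p ξ m H.one_le n (u := fun k => ι (u k))
    fun k => H.mem_dpSub (u k)
  obtain ⟨s, rfl⟩ := H.exists_of_mem_dpSub hs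
  have h2 : ∀ k, algebraMap W (Localization.Away (p : W)) ξ ^ n ∣ ι (z k) - ι (z 0) -
      ∑ j ∈ Finset.range k, (p : Localization.Away (p : W)) ^ j * ι (u j) := fun k => by
    convert Finset.dvd_sum fun j (_ : j ∈ Finset.range k) => hu j using 1
    rw [Finset.sum_sub_distrib, ← map_sum, Finset.sum_range_sub, map_sub]
  refine ⟨z 0 + s, fun k => ?_⟩
  obtain ⟨t, ht, hd⟩ := hlim k
  obtain ⟨t, rfl⟩ := H.exists_of_mem_dpSub ht
  refine ⟨z k, t, hz k, ?_⟩
  convert dvd_sub hd (h2 k) using 1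
  rw [map_add]
  ring

/-- `ξ^p` is `p^{v(p)} γ_p` with `v(p) ≥ 1`, so `p` divides `μ^p` in `X`: for `m ≥ p` the `(p,
μ)`-adic and `p`-adic topologies agree. -/
theorem pow_le_span (hm : (p : ℕ∞) ≤ m) : I ^ (p + 1) ≤ Ideal.span {(p : X)} := by
  have := H.regular.isAdicComplete
  rw [add_comm, H.ideal_eq]
  refine (span_pair_pow_le _ _ 1 p).trans ?_
  rw [pow_one, Ideal.span_le, Set.insert_subset_iff, Set.singleton_subset_iff]
  refine ⟨Ideal.mem_span_singleton_self _, Ideal.mem_span_singleton.2 ?_⟩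
  have hlt : dpVal p m (p - 1) < dpVal p m (p - 1 + 1) := dpVal_lt_succ hm (by
    rw [Nat.sub_add_cancel hp.out.one_lt.le])
  rw [Nat.sub_add_cancel hp.out.one_lt.le] at hlt
  obtain ⟨v, hv⟩ := Nat.exists_eq_add_of_lt hlt
  obtain ⟨g, hg⟩ := H.exists_of_mem_dpSub (dpGamma_mem p ξ m H.one_le p)
  obtain ⟨c, hc⟩ := H.xi_dvd
  refine ⟨(p : X) ^ (dpVal p m (p - 1) + v) * g * algebraMap W X c ^ p, H.injective ?_⟩
  rw [hc, map_pow, AlgHom.commutes, map_mul, mul_pow, ← pow_mul_dpGamma p ξ m p, hv]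
  simp only [map_mul, map_pow, map_natCast, AlgHom.commutes, hg]
  ring

theorem eq_zero_of_approx {y : AdicCompletion I X} (h : ∀ n, Approx ι I ξ n y 0) : y = 0 := by
  refine AdicCompletion.ext_evalₐ fun j => ?_
  rw [map_zero]
  have hpI : (p : X) ^ j ∈ I ^ j :=
    Ideal.pow_mem_pow (H.ideal_eq ▸ Ideal.subset_span (Set.mem_insert _ _)) j
  suffices ∃ r, j ≤ r ∧ ∃ z, AdicCompletion.evalₐ I r y = Ideal.Quotient.mk _ z ∧ z ∈ I ^ j by
    obtain ⟨r, hr, z, hz, hm⟩ := this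
    rw [evalₐ_eq_mk_of_le hr hz, Ideal.Quotient.eq_zero_iff_mem]
    exact hm
  rcases le_or_gt (p : ℕ∞) m with hm | hm
  · have hI := H.pow_le_span hm
    -- At level `(p + 1) j` two representatives differ by an element of `p^j X`. So `z₀` lies in
    -- `p^j X` modulo every `ξ^n`, and closedness of `p^j X` applies.
    refine ⟨(p + 1) * j, Nat.le_mul_of_pos_left _ (Nat.succ_pos _), ?_⟩
    obtain ⟨z₀, hz₀⟩ := exists_evalₐ_eq_mk ((p + 1) * j) y
    refine ⟨z₀, hz₀, ?_⟩
    obtain ⟨t, ht, e⟩ := H.regular.exists_eq_pow_mul_of_forall hm (k := j)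
      (H.mem_dpSub z₀) fun n => by
        obtain ⟨z, t, hz, ht⟩ := h n ((p + 1) * j)
        have h1 := Ideal.Quotient.eq.1
          ((evalₐ_eq_mk_of_le (Nat.le_add_right _ n) hz).symm.trans hz₀)
        rw [pow_mul] at h1
        have h2 := Ideal.pow_right_mono hI j h1
        rw [Ideal.span_singleton_pow, Ideal.mem_span_singleton] at h2
        obtain ⟨s, hs⟩ := h2
        refine ⟨-ι ((p : X) ^ (p * j) * t + s), neg_mem (H.mem_dpSub _), ?_⟩
        have hs' := congrArg ι hs
        rw [← dvd_neg]
        convert ht using 1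
        simp only [map_add, map_mul, map_pow, map_sub, map_natCast, map_zero] at hs' ⊢
        linear_combination hs'
    obtain ⟨t, rfl⟩ := H.exists_of_mem_dpSub ht
    have e' : z₀ = (p : X) ^ j * t := H.injective (by rw [e, map_mul, map_pow, map_natCast])
    rw [e']
    exact Ideal.mul_mem_right _ _ hpI
  -- Here `X = W`. Modulo `p^j` the representative is divisible by `ξ^(2j)`, which lies in `(p,
  -- μ)^j` because `ξ^2 ∈ (p, μ)`.
  · refine ⟨j + 2 * j, Nat.le_add_right _ _, ?_⟩
    obtain ⟨z, t, hz, ht⟩ := h (2 * j) j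
    refine ⟨z, hz, ?_⟩
    obtain ⟨w, hw⟩ := H.regular.exists_algebraMap_eq_of_lt hm
      (H.mem_dpSub (z + (p : X) ^ j * t))
    have h1 : ξ ^ (2 * j) ∣ w := H.regular.xi_pow_dvd_of_algebraMap (by
      rw [hw, ← dvd_neg]
      convert ht using 1
      simp only [map_add, map_mul, map_pow, map_natCast, map_zero]
      ring)
    have h2 : algebraMap W X w ∈ I ^ j := by
      have h3 : w ∈ Ideal.span {(p : W), μ} ^ j := by
        obtain ⟨c, rfl⟩ := h1
        rw [pow_mul]
        exact Ideal.mul_mem_right _ _ (Ideal.pow_mem_pow H.xi_sq_mem j)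
      have h4 := Ideal.mem_map_of_mem (algebraMap W X) h3
      rwa [Ideal.map_pow, Ideal.map_span, Set.image_pair, map_natCast, ← H.ideal_eq] at h4
    have h3 : z + (p : X) ^ j * t = algebraMap W X w :=
      H.injective (by rw [← hw, AlgHom.commutes])
    rw [← sub_eq_iff_eq_add.2 h3.symm]
    exact sub_mem h2 (Ideal.mul_mem_right _ _ hpI)

/-- The map from the completion of `X` to `W[1/p] / ξ ^ n`. -/
theorem exists_algHom (n : ℕ) :
    ∃ f : AdicCompletion I X →ₐ[W]
      Localization.Away (p : W) ⧸ Ideal.span {algebraMap W (Localization.Away (p : W)) ξ} ^ n,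
      ∀ y x, Approx ι I ξ n y x → f y = Ideal.Quotient.mk _ (ι x) := by
  choose g hg using H.exists_approx n
  have key : ∀ y x, Approx ι I ξ n y x →
      (Ideal.Quotient.mk (Ideal.span {algebraMap W (Localization.Away (p : W)) ξ} ^ n) (ι (g y))) =
        Ideal.Quotient.mk _ (ι x) := fun y x h => by
    rw [Ideal.Quotient.eq, Ideal.span_singleton_pow, Ideal.mem_span_singleton]
    exact H.dvd_of_approx (hg y) h
  exact ⟨{ toFun := fun y => Ideal.Quotient.mk _ (ι (g y))
           map_one' := by rw [key 1 1 (by simpa using approx_algebraMap n (1 : X))]; simp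
           map_zero' := by rw [key 0 0 (by simpa using approx_algebraMap n (0 : X))]; simp
           map_mul' := fun a b => by rw [key _ _ ((hg a).mul (hg b)), map_mul, map_mul]
           map_add' := fun a b => by rw [key _ _ ((hg a).add (hg b)), map_add, map_add]
           commutes' := fun w => by
             refine (key _ (algebraMap W X w) (approx_algebraMap n _)).trans ?_
             rw [AlgHom.commutes]; rfl }, key⟩

theorem exists_deRham :
    ∃ c : AdicCompletion I X →ₐ[W] BdRPlus p W ξ,
      (∀ x, c (algebraMap X _ x) = algebraMap (Localization.Away (p : W)) _ (ι x)) ∧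
      Function.Injective c ∧
      ∀ y n, ∃ x, AdicCompletion.evalₐ _ n (c y) = Ideal.Quotient.mk _ (ι x) := by
  choose f hf using H.exists_algHom
  have hcomp : ∀ {m n : ℕ} (hle : m ≤ n),
      (Ideal.Quotient.factorₐ W (Ideal.pow_le_pow_right hle)).comp (f n) = f m := by
    intro m n hle
    ext y
    obtain ⟨x, hx⟩ := H.exists_approx n y
    rw [AlgHom.comp_apply, hf n y x hx, hf m y x (hx.mono hle)]
    rfl
  refine ⟨AdicCompletion.liftAlgHom _ f hcomp, fun x => ?_, ?_, fun y n => ?_⟩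
  · refine AdicCompletion.ext_evalₐ fun n => ?_
    rw [AdicCompletion.evalₐ_liftAlgHom, hf n _ x (approx_algebraMap n x),
      AdicCompletion.algebraMap_apply, AdicCompletion.evalₐ_of]
    rfl
  · rw [injective_iff_map_eq_zero]
    intro y hy
    refine H.eq_zero_of_approx fun n => ?_
    obtain ⟨x, hx⟩ := H.exists_approx n y
    have h1 := congrArg (AdicCompletion.evalₐ _ n) hy
    rw [AdicCompletion.evalₐ_liftAlgHom, hf n y x hx, map_zero, Ideal.Quotient.eq_zero_iff_mem,
      Ideal.span_singleton_pow, Ideal.mem_span_singleton] at h1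
    exact hx.of_dvd (by rw [map_zero, zero_sub, dvd_neg]; exact h1)
  · obtain ⟨x, hx⟩ := H.exists_approx n y
    exact ⟨x, by rw [AdicCompletion.evalₐ_liftAlgHom, hf n y x hx]⟩

end DeRhamData

/-! ### Properties of `𝔹_dR^+` -/

section BdR

variable {p : ℕ} {W : Type*} [CommRing W] {ξ : W}

theorem BdRPlus.algebraMap_eq (w : W) : algebraMap W (BdRPlus p W ξ) w =
    algebraMap (Localization.Away (p : W)) _ (algebraMap W _ w) := rfl

theorem BdRPlus.evalₐ_algebraMap (n : ℕ) (x : Localization.Away (p : W)) :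
    AdicCompletion.evalₐ _ n (algebraMap _ (BdRPlus p W ξ) x) = Ideal.Quotient.mk _ x :=
  AdicCompletion.evalₐ_of _ n x

theorem BdRPlus.evalₐ_xi_pow_mul (n : ℕ) (w : BdRPlus p W ξ) :
    AdicCompletion.evalₐ _ n (algebraMap W (BdRPlus p W ξ) ξ ^ n * w) = 0 := by
  rw [map_mul, BdRPlus.algebraMap_eq, ← map_pow, BdRPlus.evalₐ_algebraMap,
    Ideal.Quotient.eq_zero_iff_mem.2 (Ideal.pow_mem_pow (Ideal.mem_span_singleton_self _) n),
    zero_mul]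

theorem BdRPlus.evalₐ_eq_mk_iff {n : ℕ} {y : BdRPlus p W ξ} {x : Localization.Away (p : W)} :
    AdicCompletion.evalₐ _ n y = Ideal.Quotient.mk _ x ↔
      ∃ w, y = algebraMap _ _ x + algebraMap W (BdRPlus p W ξ) ξ ^ n * w := by
  constructor
  · intro e
    have h1 := mem_map_pow_of_evalₐ_eq_zero (Submodule.fg_span (Set.finite_singleton _))
      (n := n) (y := y - algebraMap _ _ x)
      (by rw [map_sub, e, BdRPlus.evalₐ_algebraMap, sub_self])
    rw [Ideal.map_span, Set.image_singleton, Ideal.span_singleton_pow,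
      Ideal.mem_span_singleton] at h1
    obtain ⟨w, hw⟩ := h1
    exact ⟨w, by rw [BdRPlus.algebraMap_eq, ← hw]; ring⟩
  · rintro ⟨w, rfl⟩
    rw [map_add, BdRPlus.evalₐ_xi_pow_mul, BdRPlus.evalₐ_algebraMap, add_zero]

/-! ### Torsion-freeness of `𝔹_dR^+` and uniqueness of maps into it -/

namespace IsRegularSeparated

variable (h : IsRegularSeparated p ξ)
include h

theorem algebraMap_bdRPlus_injective :
    Function.Injective (algebraMap (Localization.Away (p : W)) (BdRPlus p W ξ)) := by
  rw [injective_iff_map_eq_zero]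
  intro x hx
  refine h.eq_zero_of_forall_xi_pow_dvd' fun n => ?_
  have h1 := congrArg (AdicCompletion.evalₐ _ n) hx
  rwa [BdRPlus.evalₐ_algebraMap, map_zero, Ideal.Quotient.eq_zero_iff_mem,
    Ideal.span_singleton_pow, Ideal.mem_span_singleton] at h1

theorem eq_zero_of_xi_mul {y : BdRPlus p W ξ} (e : algebraMap W (BdRPlus p W ξ) ξ * y = 0) :
    y = 0 := by
  refine AdicCompletion.ext_evalₐ fun n => ?_
  obtain ⟨x, hx⟩ := exists_evalₐ_eq_mk (n + 1) y
  have h1 := congrArg (AdicCompletion.evalₐ _ (n + 1)) e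
  rw [map_mul, hx, BdRPlus.algebraMap_eq, BdRPlus.evalₐ_algebraMap, map_zero, ← map_mul,
    Ideal.Quotient.eq_zero_iff_mem, Ideal.span_singleton_pow, Ideal.mem_span_singleton] at h1
  obtain ⟨z, hz⟩ := h1
  have h2 : x = algebraMap W _ ξ ^ n * z :=
    h.xi_pow_mul_cancel' (n := 1) (by rw [pow_one, hz]; ring)
  rw [evalₐ_eq_mk_of_le n.le_succ hx, map_zero, Ideal.Quotient.eq_zero_iff_mem,
    Ideal.span_singleton_pow, Ideal.mem_span_singleton]
  exact ⟨z, h2⟩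

omit h in
theorem eq_zero_of_mul_of_dvd {t : W} (ht : t ∣ ξ - p) {y : BdRPlus p W ξ}
    (e : algebraMap W (BdRPlus p W ξ) t * y = 0) : y = 0 := by
  obtain ⟨g, hg⟩ := ht
  obtain ⟨b, hb⟩ := (isUnit_natCast_away (W := W) p).exists_right_inv
  set b' := algebraMap _ (BdRPlus p W ξ) b
  have hb' : (p : BdRPlus p W ξ) * b' = 1 := by
    rw [← map_natCast (algebraMap (Localization.Away (p : W)) (BdRPlus p W ξ)), ← map_mul, hb,
      map_one]
  have h1 : algebraMap W (BdRPlus p W ξ) ξ - p = algebraMap W _ t * algebraMap W _ g := by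
    rw [← map_mul, ← hg, map_sub, map_natCast]
  -- From `(ξ - p) y = 0` one gets `y = ξ p⁻¹ y`; iterating, `y` is divisible by every power of `ξ`.
  have h2 : y = algebraMap W (BdRPlus p W ξ) ξ * (b' * y) := by
    linear_combination (-y) * hb' - b' * y * h1 - algebraMap W _ g * b' * e
  have h3 : ∀ n, ∃ w, y = algebraMap W (BdRPlus p W ξ) ξ ^ n * w := fun n => by
    induction n with
    | zero => exact ⟨y, by simp⟩
    | succ n ih =>
      obtain ⟨w, hw⟩ := ih
      exact ⟨b' * w, by rw [h2, hw]; ring⟩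
  refine AdicCompletion.ext_evalₐ fun n => ?_
  obtain ⟨w, hw⟩ := h3 n
  rw [hw, BdRPlus.evalₐ_xi_pow_mul, map_zero]

theorem eq_zero_of_mu_smul {t : W} (ht : t ∣ ξ - p) {y : BdRPlus p W ξ}
    (e : (t * ξ) • y = 0) : y = 0 := by
  rw [Algebra.smul_def, map_mul, mul_assoc] at e
  exact h.eq_zero_of_xi_mul (eq_zero_of_mul_of_dvd ht e)

/-- Two algebra maps to `𝔹_dR^+` that agree on a dense subset agree, provided that modulo every
`ξ ^ n` their values come from `dpSub p W ξ ⊤`. -/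
theorem algHom_bdRPlus_ext [hp : Fact p.Prime] {μ : W} (hμ : ξ ∣ μ) {X S : Type*} [CommRing S]
    [Algebra W S] (f : X → S)
    (hf : ∀ (s : S) (k : ℕ), ∃ x, s - f x ∈ Ideal.span {(p : S), algebraMap W S μ} ^ k)
    {c c' : S →ₐ[W] BdRPlus p W ξ} (hcc' : ∀ x, c (f x) = c' (f x))
    (hc : ∀ y n, ∃ z ∈ dpSub p W ξ ⊤, AdicCompletion.evalₐ _ n (c y) = Ideal.Quotient.mk _ z)
    (hc' : ∀ y n, ∃ z ∈ dpSub p W ξ ⊤, AdicCompletion.evalₐ _ n (c' y) = Ideal.Quotient.mk _ z) :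
    c = c' := by
  ext y : 1
  refine AdicCompletion.ext_evalₐ fun n => ?_
  have key : ∀ y, ∃ z ∈ dpSub p W ξ ⊤,
      AdicCompletion.evalₐ _ n (c y - c' y) = Ideal.Quotient.mk _ z := fun y => by
    obtain ⟨z, hz, e⟩ := hc y n
    obtain ⟨z', hz', e'⟩ := hc' y n
    exact ⟨z - z', sub_mem hz hz', by rw [map_sub, e, e', map_sub]⟩
  rw [← sub_eq_zero, ← map_sub]
  obtain ⟨z, hz, e⟩ := key y
  rw [e, Ideal.Quotient.eq_zero_iff_mem, Ideal.span_singleton_pow, Ideal.mem_span_singleton]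
  refine h.xi_pow_dvd_of_forall_dpSub ⊤ fun k => ?_
  -- Up to the dense subset, `y` is `p^k u + μ^n v`, so modulo `ξ^n` the difference of the two maps
  -- at `y` is `p^k` times its value at `u`. The bounded denominators stand in for continuity.
  obtain ⟨x, hx⟩ := hf y (k + n)
  obtain ⟨u, v, huv⟩ := Ideal.mem_span_pair.1 (span_pair_pow_le _ _ k n hx)
  obtain ⟨z', hz', e'⟩ := key u
  refine ⟨z', hz', ?_⟩
  obtain ⟨r, hr⟩ := hμ
  have h1 : c y - c' y = p ^ k * (c u - c' u) +
      algebraMap W (BdRPlus p W ξ) ξ ^ n * (algebraMap W _ r ^ n * (c v - c' v)) := by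
    have h2 : y = f x + (u * (p : S) ^ k + v * algebraMap W S μ ^ n) := by rw [huv]; ring
    rw [h2]
    simp only [map_add, map_mul, map_pow, map_natCast, AlgHom.commutes, hcc', hr]
    ring
  rw [← Ideal.mem_span_singleton, ← Ideal.span_singleton_pow, ← Ideal.Quotient.eq_zero_iff_mem,
    map_sub, ← e, h1, map_add, BdRPlus.evalₐ_xi_pow_mul, map_mul, map_mul, e', map_pow, map_pow,
    map_natCast, map_natCast, add_zero, sub_self]

theorem injective_of_dense [hp : Fact p.Prime] {μ : W} (hμ : ξ ∣ μ) {X S S' : Type*} [CommRing S]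
    [Algebra W S] [CommRing S'] [Algebra W S'] (g : X → S)
    (hg : ∀ (s : S) (k : ℕ), ∃ x, s - g x ∈ Ideal.span {(p : S), algebraMap W S μ} ^ k)
    {f : S →ₐ[W] S'} {c : S →ₐ[W] BdRPlus p W ξ} {d : S' →ₐ[W] BdRPlus p W ξ}
    (hinj : Function.Injective c) (hcd : ∀ x, d (f (g x)) = c (g x))
    (hc : ∀ y n, ∃ z ∈ dpSub p W ξ ⊤, AdicCompletion.evalₐ _ n (c y) = Ideal.Quotient.mk _ z)
    (hd : ∀ y n, ∃ z ∈ dpSub p W ξ ⊤, AdicCompletion.evalₐ _ n (d y) = Ideal.Quotient.mk _ z) :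
    Function.Injective f := by
  have key : d.comp f = c := h.algHom_bdRPlus_ext hμ g hg hcd (fun y n => hd (f y) n) hc
  rw [← key] at hinj
  exact Function.Injective.of_comp hinj

end IsRegularSeparated

theorem eq_zero_of_smul_eq_zero {R S T : Type*} [CommRing R] [CommRing S] [CommRing T]
    [Algebra R S] [Algebra R T] {f : S →ₐ[R] T} (hf : Function.Injective f) {r : R}
    (hr : ∀ y : T, r • y = 0 → y = 0) (x : S) (hx : r • x = 0) : x = 0 :=
  (injective_iff_map_eq_zero f).1 hf x (hr _ (by rw [← map_smul, hx, map_zero]))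

end BdR

/-! ### Completed tensor products -/

/-- A criterion for a map of completions to be injective. -/
theorem exists_completion_algHom {W X T : Type*} [CommRing W] [CommRing X] [CommRing T]
    [Algebra W X] [Algebra W T] {I : Ideal X} {J : Ideal T} (f : X →+* T) (hf : I ≤ J.comap f)
    (hd : ∀ (t : T) (k : ℕ), ∃ x, t - f x ∈ J ^ k) (ψ : T →ₐ[W] AdicCompletion I X)
    (hψ : ∀ x, ψ (f x) = algebraMap X _ x)
    (hJ : ∀ n, ∀ t ∈ J ^ n, AdicCompletion.evalₐ I n (ψ t) = 0) :
    ∃ Φ : AdicCompletion J T →ₐ[W] AdicCompletion I X,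
      (∀ t, Φ (algebraMap T _ t) = ψ t) ∧ Function.Injective Φ := by
  set g : ∀ n, T ⧸ J ^ n →ₐ[W] X ⧸ I ^ n := fun n =>
    Ideal.Quotient.liftₐ (J ^ n) (((AdicCompletion.evalₐ I n).restrictScalars W).comp ψ) (hJ n)
  have hg : ∀ n t, g n (Ideal.Quotient.mk _ t) = AdicCompletion.evalₐ I n (ψ t) :=
    fun _ _ => rfl
  have hcomp : ∀ {m n : ℕ} (hle : m ≤ n),
      (Ideal.Quotient.factorₐ W (Ideal.pow_le_pow_right hle)).comp
        ((g n).comp ((AdicCompletion.evalₐ J n).restrictScalars W)) =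
      (g m).comp ((AdicCompletion.evalₐ J m).restrictScalars W) := by
    intro m n hle
    ext y
    obtain ⟨t, ht⟩ := exists_evalₐ_eq_mk n y
    obtain ⟨x, hx⟩ := exists_evalₐ_eq_mk n (ψ t)
    simp only [AlgHom.comp_apply, AlgHom.restrictScalars_apply]
    rw [ht, evalₐ_eq_mk_of_le hle ht, hg, hg, hx, evalₐ_eq_mk_of_le hle hx]
    rfl
  refine ⟨AdicCompletion.liftAlgHom _ _ hcomp, fun t => ?_, ?_⟩
  · refine AdicCompletion.ext_evalₐ fun n => ?_
    rw [AdicCompletion.evalₐ_liftAlgHom, AdicCompletion.algebraMap_apply, AlgHom.comp_apply,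
      AlgHom.restrictScalars_apply, AdicCompletion.evalₐ_of]
    exact hg n t
  · rw [injective_iff_map_eq_zero]
    intro y hy
    refine AdicCompletion.ext_evalₐ fun n => ?_
    obtain ⟨t, ht⟩ := exists_evalₐ_eq_mk n y
    -- Density lets the class modulo `J^n` be represented by `f x`. Its image is the class of `x`,
    -- so `x ∈ I^n` and `f x ∈ J^n`.
    obtain ⟨x, hx⟩ := hd t n
    have ht' : AdicCompletion.evalₐ J n y = Ideal.Quotient.mk _ (f x) := by
      rw [ht, Ideal.Quotient.eq]; exact hx
    have h1 := congrArg (AdicCompletion.evalₐ I n) hy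
    rw [AdicCompletion.evalₐ_liftAlgHom, AlgHom.comp_apply, AlgHom.restrictScalars_apply, ht', hg,
      hψ, AdicCompletion.algebraMap_apply, AdicCompletion.evalₐ_of, map_zero,
      Ideal.Quotient.eq_zero_iff_mem] at h1
    rw [ht', map_zero, Ideal.Quotient.eq_zero_iff_mem]
    exact ((Ideal.pow_right_mono hf n).trans (Ideal.le_comap_pow f n)) h1

/-! ### Base change of divided power subalgebras -/

section Relations

variable {p : ℕ} [hp : Fact p.Prime] {W : Type*} [CommRing W] {ξ : W}
  (h : IsRegularSeparated p ξ) {m : ℕ∞} {X : Type*} [AddCommGroup X] [Module W X] {G : ℕ → X}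
  (hG : ∀ n, (p : W) ^ (dpVal p m (n + 1) - dpVal p m n) • G (n + 1) = ξ • G n)
include h hG

/-- The relations between the generators `ξ ^ n / p ^ v` follow from the obvious ones. -/
theorem sum_smul_eq_zero_of_dpGamma (w : ℕ → W) (N : ℕ) (u : W)
    (e : ∑ i ∈ Finset.range N, w i • dpGamma p ξ m i + u • dpGamma p ξ m N = 0) :
    ∑ i ∈ Finset.range N, w i • G i + u • G N = 0 := by
  induction N generalizing u with
  | zero =>
    have : u = 0 := h.algebraMap_injective (by
      simpa [Algebra.smul_def] using e)
    simp [this]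
  | succ N ih =>
    have h1 : ∃ y : W, (p : Localization.Away (p : W)) ^ dpVal p m N *
        ∑ i ∈ Finset.range (N + 1), w i • dpGamma p ξ m i = algebraMap W _ y := by
      refine ⟨∑ i ∈ Finset.range (N + 1), w i * (p ^ (dpVal p m N - dpVal p m i) * ξ ^ i), ?_⟩
      rw [Finset.mul_sum, map_sum]
      refine Finset.sum_congr rfl fun i hi => ?_
      obtain ⟨c, hc⟩ := Nat.exists_eq_add_of_le'
        (dpVal_mono (p := p) (m := m) (Nat.lt_succ_iff.1 (Finset.mem_range.1 hi)))
      rw [hc, Nat.add_sub_cancel, Algebra.smul_def, map_mul, map_mul, map_pow, map_pow,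
        map_natCast, pow_add, ← pow_mul_dpGamma p ξ m i]
      ring
    obtain ⟨y, hy⟩ := h1
    obtain ⟨c, hc⟩ := Nat.exists_eq_add_of_le (dpVal_mono (p := p) (m := m) N.le_succ)
    rw [Nat.succ_eq_add_one] at hc
    have h2 : ξ ^ (N + 1) * ((p : W) ^ dpVal p m N * u) = (p : W) ^ dpVal p m (N + 1) * -y := by
      refine h.algebraMap_injective ?_
      rw [Algebra.smul_def u] at e
      simp only [map_mul, map_pow, map_natCast, map_neg]
      rw [← pow_mul_dpGamma p ξ m (N + 1), ← hy]
      linear_combination (p : Localization.Away (p : W)) ^ (dpVal p m N + dpVal p m (N + 1)) * e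
    -- Clearing denominators shows that the top coefficient absorbs the jump of `v`, so the given
    -- relation rewrites the last term as a multiple of `G N`. The separate coefficient `u` is there
    -- to collect it.
    have h3 : (p : W) ^ c ∣ u := by
      refine h.pow_dvd_of_dvd_mul (n := N + 1) ⟨-y, h.pow_mul_cancel (k := dpVal p m N) ?_⟩
      rw [hc] at h2
      linear_combination h2
    obtain ⟨u', rfl⟩ := h3
    have hd : dpVal p m (N + 1) - dpVal p m N = c := by omega
    have h4 := pow_smul_dpGamma_succ p ξ m N
    have h5 := hG N
    rw [hd] at h4 h5
    rw [mul_comm, mul_smul, h5, smul_smul, Finset.sum_range_succ, add_assoc, ← add_smul]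
    refine ih _ ?_
    rw [mul_comm (_ ^ c), mul_smul, h4, smul_smul, Finset.sum_range_succ, add_assoc,
      ← add_smul] at e
    exact e

end Relations

section BaseChange

variable (p : ℕ) [hp : Fact p.Prime] {B : Type*} [CommRing B]
  [IsAdicComplete (Ideal.span {(p : B)}) B] (W : Type*) [CommRing W] [Algebra B W] (ξ μ : B)
  (m : ℕ∞)

omit hp [IsAdicComplete (Ideal.span {(p : B)}) B] in
theorem locMap_algebraMap (b : B) :
    locMap p B W (algebraMap B _ b) = algebraMap W _ (algebraMap B W b) :=
  IsLocalization.lift_eq _ b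

omit hp [IsAdicComplete (Ideal.span {(p : B)}) B] in
theorem locMap_dpGamma (n : ℕ) :
    locMap p B W (dpGamma p ξ m n) = dpGamma p (algebraMap B W ξ) m n := by
  refine pow_natCast_mul_cancel (k := dpVal p m n) ?_
  rw [pow_mul_dpGamma, ← map_pow, ← map_pow, ← locMap_algebraMap, map_pow (algebraMap B _),
    ← pow_mul_dpGamma p ξ m n, map_mul, map_pow, map_natCast]

/-- The map `A_cris^{0,(m)} → 𝔸_inf(R')[1/p]`. -/
def dpSubToLoc : dpSub p B ξ m →ₐ[B] Localization.Away (p : W) where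
  __ := (locMap p B W).comp (dpSub p B ξ m).val.toRingHom
  commutes' b := locMap_algebraMap p W b

/-- The map `𝔸_inf(R') ⊗ A_cris^{0,(m)} → 𝔸_inf(R')[1/p]`. -/
def baseChangeToLoc : W ⊗[B] dpSub p B ξ m →ₐ[W] Localization.Away (p : W) :=
  Algebra.TensorProduct.lift (Algebra.ofId W _) (dpSubToLoc p W ξ m) fun _ _ => Commute.all _ _

omit hp [IsAdicComplete (Ideal.span {(p : B)}) B] in
theorem baseChangeToLoc_tmul (w : W) (x : dpSub p B ξ m) :
    baseChangeToLoc p W ξ m (w ⊗ₜ x) = w • locMap p B W x := by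
  rw [baseChangeToLoc, Algebra.TensorProduct.lift_tmul, Algebra.smul_def]
  rfl

variable (hm : 1 ≤ m)
include hm

theorem exists_eq_sum_baseChange (x : W ⊗[B] dpSub p B ξ m) :
    ∃ (N : ℕ) (w : ℕ → W), ∀ n, N ≤ n → x = ∑ i ∈ Finset.range n,
      w i • ((1 : W) ⊗ₜ[B] (⟨dpGamma p ξ m i, dpGamma_mem p ξ m hm i⟩ : dpSub p B ξ m)) := by
  induction x using TensorProduct.induction_on with
  | zero => exact ⟨0, 0, fun n _ => by simp⟩
  | tmul w d =>
    obtain ⟨N, b, hb⟩ := exists_eq_sum_of_mem_dpSub p ξ m d.2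
    refine ⟨N, fun i => b i • w, fun n hn => ?_⟩
    have h1 : d = ∑ i ∈ Finset.range n,
        b i • (⟨dpGamma p ξ m i, dpGamma_mem p ξ m hm i⟩ : dpSub p B ξ m) :=
      Subtype.ext (by rw [hb n hn]; simp)
    conv_lhs => rw [h1, TensorProduct.tmul_sum]
    refine Finset.sum_congr rfl fun i _ => ?_
    rw [← TensorProduct.smul_tmul, TensorProduct.smul_tmul', smul_eq_mul, mul_one]
  | add x y hx hy =>
    obtain ⟨N, w, hw⟩ := hx
    obtain ⟨N', w', hw'⟩ := hy
    refine ⟨N + N', w + w', fun n hn => ?_⟩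
    rw [hw n (by omega), hw' n (by omega), ← Finset.sum_add_distrib]
    simp only [Pi.add_apply, add_smul]

theorem baseChangeToLoc_sum (w : ℕ → W) (n : ℕ) :
    baseChangeToLoc p W ξ m (∑ i ∈ Finset.range n,
      w i • ((1 : W) ⊗ₜ[B] (⟨dpGamma p ξ m i, dpGamma_mem p ξ m hm i⟩ : dpSub p B ξ m))) =
    ∑ i ∈ Finset.range n, w i • dpGamma p (algebraMap B W ξ) m i := by
  rw [map_sum]
  refine Finset.sum_congr rfl fun i _ => ?_
  rw [map_smul, baseChangeToLoc_tmul, one_smul, locMap_dpGamma]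

variable {W ξ} (h : IsRegularSeparated p (algebraMap B W ξ))
include h

/-- The elements `1 ⊗ γ_n` satisfy the basic relations, already over `B`, and these imply every
relation that holds in `W[1/p]`. -/
theorem baseChangeToLoc_injective : Function.Injective (baseChangeToLoc p W ξ m) := by
  rw [injective_iff_map_eq_zero]
  intro x hx
  obtain ⟨N, w, hw⟩ := exists_eq_sum_baseChange p W ξ m hm x
  have e := hw (N + 1) N.le_succ
  rw [e, baseChangeToLoc_sum p W ξ m hm, Finset.sum_range_succ] at hx
  rw [e, Finset.sum_range_succ]
  refine sum_smul_eq_zero_of_dpGamma h (G := fun i => (1 : W) ⊗ₜ[B]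
    (⟨dpGamma p ξ m i, dpGamma_mem p ξ m hm i⟩ : dpSub p B ξ m)) (fun n => ?_) w N (w N) hx
  have h1 := pow_smul_dpGamma_succ p ξ m n
  have h2 : (p : B) ^ (dpVal p m (n + 1) - dpVal p m n) •
      (⟨dpGamma p ξ m (n + 1), dpGamma_mem p ξ m hm (n + 1)⟩ : dpSub p B ξ m) =
      ξ • (⟨dpGamma p ξ m n, dpGamma_mem p ξ m hm n⟩ : dpSub p B ξ m) := Subtype.ext h1
  have h3 : (p : W) ^ (dpVal p m (n + 1) - dpVal p m n) =
      algebraMap B W ((p : B) ^ (dpVal p m (n + 1) - dpVal p m n)) := by simp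
  rw [h3, algebraMap_smul, algebraMap_smul, ← TensorProduct.tmul_smul, ← TensorProduct.tmul_smul,
    h2]

theorem baseChangeToLoc_range :
    (baseChangeToLoc p W ξ m).range = dpSub p W (algebraMap B W ξ) m := by
  have := h.isAdicComplete
  refine le_antisymm ?_ fun x hx => ?_
  · rintro _ ⟨x, rfl⟩
    obtain ⟨N, w, hw⟩ := exists_eq_sum_baseChange p W ξ m hm x
    have e := hw N le_rfl
    change baseChangeToLoc p W ξ m x ∈ _
    rw [e, baseChangeToLoc_sum p W ξ m hm]
    exact sum_mem fun i _ => Subalgebra.smul_mem _ (dpGamma_mem p _ m hm i) _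
  · obtain ⟨N, w, hw⟩ := exists_eq_sum_of_mem_dpSub p _ m hx
    rw [hw N le_rfl, ← baseChangeToLoc_sum p W ξ m hm]
    exact ⟨_, rfl⟩

theorem deRhamData_baseChange (h1 : ξ ∣ μ) (h2 : ξ ^ 2 ∈ Ideal.span {(p : B), μ}) :
    DeRhamData p (algebraMap B W ξ) (algebraMap B W μ) m (baseChangeToLoc p W ξ m)
      (pMuIdeal p B μ (W ⊗[B] dpSub p B ξ m)) where
  regular := h
  one_le := hm
  injective := baseChangeToLoc_injective p m hm h
  range_eq := baseChangeToLoc_range p m hm h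
  ideal_eq := by rw [pMuIdeal, ← IsScalarTower.algebraMap_apply]
  xi_dvd := map_dvd _ h1
  xi_sq_mem := by
    have := Ideal.mem_map_of_mem (algebraMap B W) h2
    rwa [map_pow, Ideal.map_span, Set.image_pair, map_natCast] at this

end BaseChange

/-! ### Density of `𝔸_inf(R') ⊗ A_cris^{0,(m)}` -/

section Density

variable (p : ℕ) {B : Type*} [CommRing B] (W : Type*) [CommRing W] [Algebra B W] (ξ μ : B)
  (m : ℕ∞)

theorem pMuIdeal_fg (S : Type*) [CommRing S] [Algebra B S] : (pMuIdeal p B μ S).FG :=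
  Submodule.fg_span ((Set.finite_singleton _).insert _)

theorem pMuIdeal_map_completion (S : Type*) [CommRing S] [Algebra B S] (I : Ideal S) :
    (pMuIdeal p B μ S).map (algebraMap S (AdicCompletion I S)) =
      pMuIdeal p B μ (AdicCompletion I S) := by
  rw [pMuIdeal, Ideal.map_span, Set.image_pair, map_natCast]
  rfl

theorem exists_sub_algebraMap_mem_pow (S : Type*) [CommRing S] [Algebra B S]
    (y : AdicCompletion (pMuIdeal p B μ S) S) (k : ℕ) :
    ∃ s : S, y - algebraMap S _ s ∈
      pMuIdeal p B μ (AdicCompletion (pMuIdeal p B μ S) S) ^ k := by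
  obtain ⟨s, hs⟩ := exists_evalₐ_eq_mk k y
  refine ⟨s, ?_⟩
  rw [← pMuIdeal_map_completion]
  exact mem_map_pow_of_evalₐ_eq_zero (pMuIdeal_fg p μ S) (by
    rw [map_sub, hs, AdicCompletion.algebraMap_apply, AdicCompletion.evalₐ_of]
    exact sub_self _)

theorem evalₐ_eq_zero_of_mem {S : Type*} [CommRing S] {I : Ideal S} {n : ℕ}
    {y : AdicCompletion I S} (h : y ∈ I.map (algebraMap S (AdicCompletion I S)) ^ n) :
    AdicCompletion.evalₐ I n y = 0 := by
  rw [← Ideal.map_pow] at h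
  refine (Ideal.map_le_iff_le_comap (K := RingHom.ker (AdicCompletion.evalₐ I n))).2
    (fun s hs => ?_) h
  rw [Ideal.mem_comap, RingHom.mem_ker, AdicCompletion.algebraMap_apply, AdicCompletion.evalₐ_of]
  exact Ideal.Quotient.eq_zero_iff_mem.2 hs

/-- The map `𝔸_inf(R') ⊗ A_cris^{0,(m)} → 𝔸_inf(R') ⊗ A_cris^(m)`. -/
def baseChangeToHat : W ⊗[B] dpSub p B ξ m →ₐ[W] W ⊗[B] CrisHat p B ξ μ m :=
  Algebra.TensorProduct.map (AlgHom.id W W) (IsScalarTower.toAlgHom B _ _)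

theorem exists_sub_baseChangeToHat_mem_pow (t : W ⊗[B] CrisHat p B ξ μ m) (k : ℕ) :
    ∃ x, t - baseChangeToHat p W ξ μ m x ∈ pMuIdeal p B μ (W ⊗[B] CrisHat p B ξ μ m) ^ k := by
  induction t using TensorProduct.induction_on with
  | zero => exact ⟨0, by simp⟩
  | tmul w y =>
    obtain ⟨s, hs⟩ := exists_sub_algebraMap_mem_pow p μ _ y k
    refine ⟨w ⊗ₜ s, ?_⟩
    have h1 := pow_le_comap_pow (pMuIdeal_le_comap p B μ (Algebra.TensorProduct.includeRight :
      CrisHat p B ξ μ m →ₐ[B] W ⊗[B] CrisHat p B ξ μ m)) k hs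
    rw [Ideal.mem_comap] at h1
    have h2 := Ideal.mul_mem_left _ (w ⊗ₜ (1 : CrisHat p B ξ μ m)) h1
    convert h2 using 1
    rw [Algebra.TensorProduct.includeRight_apply, Algebra.TensorProduct.tmul_mul_tmul, mul_one,
      one_mul, TensorProduct.tmul_sub]
    rfl
  | add t t' ht ht' =>
    obtain ⟨x, hx⟩ := ht
    obtain ⟨x', hx'⟩ := ht'
    refine ⟨x + x', ?_⟩
    convert add_mem hx hx' using 1
    rw [map_add]
    ring

/-- The map `𝔸_inf(R') ⊗ A_cris^{0,(m)} → 𝔸_cris^(m)(R')`. -/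
def baseChangeToRelCris : W ⊗[B] dpSub p B ξ m →ₐ[W] RelCris p B W ξ μ m :=
  (IsScalarTower.toAlgHom W (W ⊗[B] CrisHat p B ξ μ m) _).comp (baseChangeToHat p W ξ μ m)

theorem baseChangeToRelCris_one_tmul (x : dpSub p B ξ m) :
    baseChangeToRelCris p W ξ μ m (1 ⊗ₜ x) = toRelCris p B W ξ μ m x := rfl

theorem baseChangeToRelCris_tmul (w : W) (x : dpSub p B ξ m) :
    baseChangeToRelCris p W ξ μ m (w ⊗ₜ x) = w • toRelCris p B W ξ μ m x := by
  rw [← baseChangeToRelCris_one_tmul, ← map_smul, TensorProduct.smul_tmul', smul_eq_mul, mul_one]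

theorem exists_sub_baseChangeToRelCris_mem_pow (y : RelCris p B W ξ μ m) (k : ℕ) :
    ∃ x, y - baseChangeToRelCris p W ξ μ m x ∈
      Ideal.span {(p : RelCris p B W ξ μ m), algebraMap W _ (algebraMap B W μ)} ^ k := by
  change ∃ x, _ ∈ pMuIdeal p B μ (RelCris p B W ξ μ m) ^ k
  obtain ⟨t, ht⟩ := exists_sub_algebraMap_mem_pow p μ _ y k
  obtain ⟨x, hx⟩ := exists_sub_baseChangeToHat_mem_pow p W ξ μ m t k
  refine ⟨x, ?_⟩
  have h1 := Ideal.mem_map_of_mem (algebraMap _ (RelCris p B W ξ μ m)) hx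
  rw [Ideal.map_pow, pMuIdeal_map_completion] at h1
  convert add_mem ht h1 using 1
  rw [map_sub]
  exact (sub_add_sub_cancel _ _ _).symm

theorem exists_relCris_algHom :
    ∃ Φ : RelCris p B W ξ μ m →ₐ[W]
        AdicCompletion (pMuIdeal p B μ (W ⊗[B] dpSub p B ξ m)) (W ⊗[B] dpSub p B ξ m),
      (∀ x, Φ (baseChangeToRelCris p W ξ μ m x) = algebraMap _ _ x) ∧ Function.Injective Φ := by
  set X := W ⊗[B] dpSub p B ξ m with hX
  set I := pMuIdeal p B μ X
  -- Completing `s ↦ 1 ⊗ s` and extending `W`-linearly gives a map back to the completion of `X`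
  -- that restricts to the canonical map on `X`, as the injectivity criterion requires.
  let ψ : W ⊗[B] CrisHat p B ξ μ m →ₐ[W] AdicCompletion I X :=
    Algebra.TensorProduct.lift (Algebra.ofId W _)
      (completionMap _ I (Algebra.TensorProduct.includeRight : dpSub p B ξ m →ₐ[B] X)
        (pMuIdeal_le_comap p B μ _)) fun _ _ => Commute.all _ _
  have hψ : ∀ x, ψ (baseChangeToHat p W ξ μ m x) = algebraMap X _ x := by
    have : ψ.comp (baseChangeToHat p W ξ μ m) = IsScalarTower.toAlgHom W X _ := by
      refine Algebra.TensorProduct.ext' fun w s => ?_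
      have h1 : w ⊗ₜ s = algebraMap W X w * ((1 : W) ⊗ₜ[B] s) := by
        rw [← Algebra.smul_def, TensorProduct.smul_tmul', smul_eq_mul, mul_one]
      have h2 : ψ (w ⊗ₜ algebraMap _ _ s) = algebraMap W _ w * algebraMap X _ (1 ⊗ₜ s) := by
        rw [Algebra.TensorProduct.lift_tmul, completionMap_of]
        rfl
      refine h2.trans ?_
      rw [IsScalarTower.toAlgHom_apply, h1, map_mul]
      rfl
    exact fun x => DFunLike.congr_fun this x
  obtain ⟨Φ, h1, h2⟩ := exists_completion_algHom (I := I)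
    (J := pMuIdeal p B μ (W ⊗[B] CrisHat p B ξ μ m))
    (baseChangeToHat p W ξ μ m).toRingHom
    (pMuIdeal_le_comap p B μ ((baseChangeToHat p W ξ μ m).restrictScalars B))
    (exists_sub_baseChangeToHat_mem_pow p W ξ μ m) ψ hψ fun n t ht => by
      have h1 := pow_le_comap_pow (pMuIdeal_le_comap p B μ (ψ.restrictScalars B)) n ht
      rw [Ideal.mem_comap, ← pMuIdeal_map_completion] at h1
      exact evalₐ_eq_zero_of_mem h1
  exact ⟨Φ, fun x => (h1 _).trans (hψ x), h2⟩

end Density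

/-! ### Roots of unity in tilts -/

/-- `p = Φ_{p^{k+1}}(1)` is the product of `1 - ζ^j` over `j` prime to `p`, and each factor is a
unit times `ζ - 1`. -/
theorem associated_natCast_sub_one_pow {p : ℕ} [hp : Fact p.Prime] {O : Type*} [CommRing O]
    [IsDomain O] {k : ℕ} {ζ : O} (h : IsPrimitiveRoot ζ (p ^ (k + 1))) :
    Associated (p : O) ((ζ - 1) ^ (p ^ (k + 1)).totient) := by
  have : NeZero (p ^ (k + 1)) := ⟨pow_ne_zero _ hp.out.ne_zero⟩
  have h1 := congrArg (Polynomial.eval 1) (Polynomial.cyclotomic_eq_prod_X_sub_primitiveRoots h)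
  rw [Polynomial.eval_one_cyclotomic_prime_pow, Polynomial.eval_prod] at h1
  rw [h1, ← h.card_primitiveRoots, ← Finset.prod_const]
  refine Associated.prod _ _ _ fun μ hμ => ?_
  obtain ⟨j, -, hj, rfl⟩ := h.isPrimitiveRoot_iff.1
    (isPrimitiveRoot_of_mem_primitiveRoots hμ)
  rw [Polynomial.eval_sub, Polynomial.eval_X, Polynomial.eval_C, ← neg_sub]
  exact (h.associated_sub_one_pow_sub_one_of_coprime hj).symm.neg_left

section Tilt

variable {p : ℕ} [hp : Fact p.Prime] {R : Type*} [CommRing R] [Fact ¬ IsUnit (p : R)]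
  {e : PreTilt R p} {z : ℕ → R} (he : ∀ i, PreTilt.coeff i e = Ideal.Quotient.mk _ (z i))
  (hz : ∀ k, Associated (p : R) (z (k + 1) ^ (p ^ (k + 1)).totient))
include he hz

theorem eq_zero_of_mul_tilt (hreg : ∀ k x, z (k + 1) * x = 0 → x = 0) {x : PreTilt R p}
    (hx : e * x = 0) : x = 0 := by
  have key : ∀ j, PreTilt.coeff (j + 2) x = 0 := fun j => by
    obtain ⟨y, hy⟩ := Ideal.Quotient.mk_surjective (PreTilt.coeff (j + 3) x)
    have h1 := congrArg (PreTilt.coeff (j + 3)) hx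
    rw [map_mul, he, ← hy, map_zero, ← map_mul, Ideal.Quotient.eq_zero_iff_mem,
      Ideal.mem_span_singleton] at h1
    obtain ⟨r, hr⟩ := h1
    -- The index is taken large enough that `φ(p^(j+3)) ≥ p`, so `p` is a multiple of the `p`-th
    -- power of `z (j + 3)`.
    have hle : p ≤ (p ^ (j + 2 + 1)).totient := by
      rw [Nat.totient_prime_pow_succ hp.out]
      calc p ≤ p ^ (j + 2) := Nat.le_self_pow (by omega) p
        _ ≤ p ^ (j + 2) * (p - 1) := Nat.le_mul_of_pos_right _ (Nat.sub_pos_of_lt hp.out.one_lt)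
    obtain ⟨s, hs⟩ := (pow_dvd_pow (z (j + 3)) hle).trans (hz (j + 2)).dvd'
    have hpow : ∀ n a, z (j + 3) ^ n * a = 0 → a = 0 := fun n => by
      induction n with
      | zero => intro a ha; simpa using ha
      | succ n ih => intro a ha; exact ih a (hreg _ _ (by rw [← mul_assoc, ← pow_succ']; exact ha))
    -- Raise `z y = p r` to the `p`-th power and cancel `z^p` against one factor `p`. The remaining
    -- `p^(p-1)` makes `y^p`, which lifts the previous component of `x`, vanish modulo `p`.
    have hyp : y ^ p = s * p ^ (p - 1) * r ^ p := by
      refine sub_eq_zero.1 (hpow p _ ?_)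
      have h2 : (p : R) ^ p = p * p ^ (p - 1) := by
        rw [← pow_succ', Nat.sub_add_cancel hp.out.one_lt.le]
      rw [mul_sub, ← mul_pow, hr, mul_pow, h2]
      nth_rw 1 [hs]
      ring
    rw [← PreTilt.coeff_pow_p, ← hy, ← map_pow, hyp, Ideal.Quotient.eq_zero_iff_mem,
      Ideal.mem_span_singleton]
    exact ((dvd_pow_self (p : R) (Nat.sub_pos_of_lt hp.out.one_lt).ne').mul_left s).mul_right _
  refine Perfection.ext fun j => ?_
  change PreTilt.coeff j x = 0
  rw [← PreTilt.coeff_pow_p, ← PreTilt.coeff_pow_p, key, zero_pow hp.out.ne_zero,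
    zero_pow hp.out.ne_zero]

/-- In each component of positive index a suitable power of `e` vanishes, since the corresponding
power of `z` is `p` up to a unit. -/
theorem eq_zero_of_forall_pow_dvd_tilt {x : PreTilt R p} (hx : ∀ n, e ^ n ∣ x) : x = 0 := by
  have key : ∀ j, PreTilt.coeff (j + 1) x = 0 := fun j => by
    obtain ⟨y, rfl⟩ := hx (p ^ (j + 1)).totient
    rw [map_mul, map_pow, he, ← map_pow,
      Ideal.Quotient.eq_zero_iff_mem.2 (Ideal.mem_span_singleton.2 (hz j).dvd), zero_mul]
  refine Perfection.ext fun j => ?_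
  change PreTilt.coeff j x = 0
  rw [← PreTilt.coeff_pow_p, key, zero_pow hp.out.ne_zero]

end Tilt

/-- Reduction modulo `p` is the constant coefficient. There `ξ` divides `μ` and `μ` divides `ξ^2`,
so regularity and separatedness pass from `μ` to `ξ`. -/
theorem isRegularSeparated_wittVector {p : ℕ} [hp : Fact p.Prime] {k : Type*} [CommRing k]
    [CharP k p] [PerfectRing k p] {ξ μ : WittVector p k} (h1 : ξ ∣ μ)
    (h2 : ξ ^ 2 ∈ Ideal.span {(p : WittVector p k), μ})
    (hreg : ∀ x, WittVector.constantCoeff μ * x = 0 → x = 0)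
    (hsep : ∀ x, (∀ n, WittVector.constantCoeff μ ^ n ∣ x) → x = 0) :
    IsRegularSeparated p ξ := by
  have hdvd : ∀ x : WittVector p k, (p : WittVector p k) ∣ x ↔ WittVector.constantCoeff x = 0 :=
    fun x => by
      rw [← Ideal.mem_span_singleton, WittVector.mem_span_p_iff_coeff_zero_eq_zero]; rfl
  have hp0 : WittVector.constantCoeff (p : WittVector p k) = 0 := (hdvd _).1 dvd_rfl
  refine ⟨fun x hx => WittVector.eq_zero_of_p_mul_eq_zero x (by rwa [mul_comm]), inferInstance,
    fun x hx => ?_, fun x hx => ?_⟩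
  · rw [hdvd, map_mul] at hx
    obtain ⟨c, rfl⟩ := h1
    rw [hdvd]
    exact hreg _ (by rw [map_mul, mul_right_comm, hx, zero_mul])
  · rw [hdvd]
    refine hsep _ fun n => ?_
    obtain ⟨a, b, rfl⟩ := hx (2 * n)
    obtain ⟨s, t, hst⟩ := Ideal.mem_span_pair.1 h2
    rw [map_add, map_mul, hp0, zero_mul, zero_add, pow_mul, ← hst, map_mul, map_pow, map_add,
      map_mul, map_mul, hp0, mul_zero, zero_add, mul_pow]
    exact ((dvd_mul_left _ _)).mul_right _

/-! ### The relations between `ξ`, `μ` and `[ε^{1/p}] - 1` -/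

section Xi

variable {p : ℕ} [Fact p.Prime] {C : Type*} [NormedField C] [IsUltrametricDist C]
  [Fact (‖(p : C)‖ < 1)] (ζ : RootSystem p C)

/-- The Teichmüller lift of `ε^{1/p}`. -/
def RootSystem.tau : Ainf p C :=
  WittVector.teichmuller p ((frobeniusEquiv (PreTilt (OC C) p) p).symm ζ.eps)

theorem RootSystem.tau_sub_one_mul_xi : (ζ.tau - 1) * ζ.xi = ζ.mu := by
  have h1 : ζ.tau ^ p = WittVector.teichmuller p ζ.eps := by
    rw [RootSystem.tau, ← map_pow, ← frobenius_def, ← coe_frobeniusEquiv,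
      RingEquiv.apply_symm_apply]
  rw [RootSystem.mu, ← h1]
  exact mul_geom_sum _ _

theorem RootSystem.tau_sub_one_dvd : ζ.tau - 1 ∣ ζ.xi - p := by
  have : ζ.xi - p = ∑ i ∈ Finset.range p, (ζ.tau ^ i - 1) := by
    rw [Finset.sum_sub_distrib]; simp [RootSystem.xi, RootSystem.tau]
  rw [this]
  exact Finset.dvd_sum fun i _ => sub_one_dvd_pow_sub_one _ i

theorem RootSystem.xi_dvd_mu : ζ.xi ∣ ζ.mu := ⟨_, by rw [mul_comm, ζ.tau_sub_one_mul_xi]⟩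

theorem RootSystem.xi_sq_mem : ζ.xi ^ 2 ∈ Ideal.span {(p : Ainf p C), ζ.mu} := by
  -- With `ξ = p + (τ - 1) g` and `(τ - 1) ξ = μ`, multiplication by `ξ` gives `ξ^2 = p ξ + g μ`.
  obtain ⟨g, hg⟩ := ζ.tau_sub_one_dvd
  exact Ideal.mem_span_pair.2 ⟨ζ.xi, g, by
    rw [← ζ.tau_sub_one_mul_xi]; linear_combination -ζ.xi * hg⟩

end Xi

/-! ### Regularity of `ξ` in `𝔸_inf(R')` -/

namespace AffinoidPerfectoid

variable {p : ℕ} [hp : Fact p.Prime] {C : Type*} [NormedField C] [IsUltrametricDist C]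
  {A : Type*} [NormedCommRing A] [NormedAlgebra C A] (P : AffinoidPerfectoid p C A)
  [CharZero C] [Fact (‖(p : C)‖ < 1)] [Nontrivial A] (ζ : RootSystem p C)

theorem isRegularSeparated_xi :
    IsRegularSeparated p (algebraMap (Ainf p C) P.AAinf ζ.xi) := by
  set z : ℕ → P.plus := fun i => P.structureMap (⟨ζ.root i, ζ.root_mem i⟩ - 1) with hzdef
  have hroot : ∀ i, IsPrimitiveRoot (⟨ζ.root i, ζ.root_mem i⟩ : OC C) (p ^ i) := fun i =>
    IsPrimitiveRoot.of_map_of_injective (f := (OC C).subtype) (ζ.isPrimitiveRoot i)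
      Subtype.val_injective
  have hz : ∀ k, Associated (p : P.plus) (z (k + 1) ^ (p ^ (k + 1)).totient) := fun k => by
    have := (associated_natCast_sub_one_pow (hroot (k + 1))).map P.structureMap
    rwa [map_natCast, map_pow] at this
  have hreg : ∀ k x, z (k + 1) * x = 0 → x = 0 := fun k x hx => by
    have h1 : ζ.root (k + 1) - 1 ≠ 0 := sub_ne_zero.2
      ((ζ.isPrimitiveRoot (k + 1)).ne_one (Nat.one_lt_pow k.succ_ne_zero hp.out.one_lt))
    have h2 : (ζ.root (k + 1) - 1) • (x : A) = 0 := by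
      rw [Algebra.smul_def]; exact congrArg Subtype.val hx
    exact Subtype.ext ((smul_eq_zero.1 h2).resolve_left h1)
  have hcoeff : WittVector.constantCoeff (algebraMap (Ainf p C) P.AAinf ζ.mu) =
      P.tiltMap ζ.eps - 1 := by
    have h1 : algebraMap (Ainf p C) P.AAinf ζ.mu =
        WittVector.teichmuller p (P.tiltMap ζ.eps) - 1 := by
      rw [RootSystem.mu, map_sub, map_one]
      congr 1
      exact WittVector.map_teichmuller p P.tiltMap _
    rw [h1, map_sub, map_one]
    congr 1
  have he : ∀ i, PreTilt.coeff i (P.tiltMap ζ.eps - 1) = Ideal.Quotient.mk _ (z i) := fun i => by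
    rw [map_sub, map_one, hzdef]
    simp only [map_sub, map_one]
    rfl
  refine isRegularSeparated_wittVector (map_dvd _ ζ.xi_dvd_mu) ?_ (fun x hx => ?_) fun x hx => ?_
  · have := Ideal.mem_map_of_mem (algebraMap (Ainf p C) P.AAinf) ζ.xi_sq_mem
    rwa [map_pow, Ideal.map_span, Set.image_pair, map_natCast] at this
  · rw [hcoeff] at hx
    exact eq_zero_of_mul_tilt he hz hreg hx
  · rw [hcoeff] at hx
    exact eq_zero_of_forall_pow_dvd_tilt he hz hx

end AffinoidPerfectoid

/-! ### The canonical maps -/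

section Canonical

variable {p : ℕ} [hp : Fact p.Prime] {B : Type*} [CommRing B]
  [IsAdicComplete (Ideal.span {(p : B)}) B] {W : Type*} [CommRing W] [Algebra B W] {ξ μ : B}
  (h : IsRegularSeparated p (algebraMap B W ξ))

omit hp [IsAdicComplete (Ideal.span {(p : B)}) B] in
theorem baseChangeToRelCris_ext {m : ℕ∞} {S : Type*} [CommRing S] [Algebra W S]
    {f : RelCris p B W ξ μ m →ₐ[W] S} {g : W ⊗[B] dpSub p B ξ m →ₐ[W] S}
    (hfg : ∀ x, f (toRelCris p B W ξ μ m x) = g (1 ⊗ₜ x)) (x : W ⊗[B] dpSub p B ξ m) :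
    f (baseChangeToRelCris p W ξ μ m x) = g x := by
  induction x using TensorProduct.induction_on with
  | zero => rw [map_zero, map_zero, map_zero]
  | tmul w s =>
    rw [baseChangeToRelCris_tmul, map_smul, hfg, ← map_smul, TensorProduct.smul_tmul',
      smul_eq_mul, mul_one]
  | add x y hx hy => rw [map_add, map_add, hx, hy, map_add]

include h

theorem exists_relCris_deRham {m : ℕ∞} (hm : 1 ≤ m) (h1 : ξ ∣ μ)
    (h2 : ξ ^ 2 ∈ Ideal.span {(p : B), μ}) :
    ∃ c : RelCris p B W ξ μ m →ₐ[W] BdRPlus p W (algebraMap B W ξ),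
      (∀ x, c (baseChangeToRelCris p W ξ μ m x) =
        algebraMap (Localization.Away (p : W)) _ (baseChangeToLoc p W ξ m x)) ∧
      Function.Injective c ∧
      ∀ y n, ∃ z ∈ dpSub p W (algebraMap B W ξ) ⊤,
        AdicCompletion.evalₐ _ n (c y) = Ideal.Quotient.mk _ z := by
  have H := deRhamData_baseChange p μ m hm h h1 h2
  obtain ⟨c, hc1, hc2, hc3⟩ := H.exists_deRham
  obtain ⟨Φ, hΦ1, hΦ2⟩ := exists_relCris_algHom p W ξ μ m
  refine ⟨c.comp Φ, fun x => ?_, hc2.comp hΦ2, fun y n => ?_⟩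
  · rw [AlgHom.comp_apply, hΦ1, hc1]
  · obtain ⟨x, hx⟩ := hc3 (Φ y) n
    exact ⟨_, dpSub_mono p W _ le_top (H.mem_dpSub x), hx⟩

omit [IsAdicComplete (Ideal.span {(p : B)}) B] in
theorem eq_of_isDeRhamMap (h1 : ξ ∣ μ) {m : ℕ∞}
    {c c' : RelCris p B W ξ μ m →ₐ[W] BdRPlus p W (algebraMap B W ξ)}
    (hcc' : ∀ x, c (baseChangeToRelCris p W ξ μ m x) = c' (baseChangeToRelCris p W ξ μ m x))
    (hc : ∀ y n, ∃ z ∈ dpSub p W (algebraMap B W ξ) ⊤,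
      AdicCompletion.evalₐ _ n (c y) = Ideal.Quotient.mk _ z)
    (hc' : ∀ y n, ∃ z ∈ dpSub p W (algebraMap B W ξ) ⊤,
      AdicCompletion.evalₐ _ n (c' y) = Ideal.Quotient.mk _ z) : c = c' :=
  h.algHom_bdRPlus_ext (map_dvd _ h1) _ (exists_sub_baseChangeToRelCris_mem_pow p W ξ μ m) hcc'
    hc hc'

omit h hp [IsAdicComplete (Ideal.span {(p : B)}) B] in
theorem isDeRhamMap_iff {c : RelCris p B W ξ μ ⊤ →ₐ[W] BdRPlus p W (algebraMap B W ξ)} :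
    IsDeRhamMap p B W ξ μ c ↔
      (∀ x, c (baseChangeToRelCris p W ξ μ ⊤ x) =
        algebraMap (Localization.Away (p : W)) _ (baseChangeToLoc p W ξ ⊤ x)) ∧
      ∀ y n, ∃ z ∈ dpSub p W (algebraMap B W ξ) ⊤,
        AdicCompletion.evalₐ _ n (c y) = Ideal.Quotient.mk _ z := by
  simp only [BdRPlus.evalₐ_eq_mk_iff]
  refine and_congr_left fun _ => ⟨fun hc => ?_, fun hc x => ?_⟩
  · refine baseChangeToRelCris_ext (g := (IsScalarTower.toAlgHom W (Localization.Away (p : W))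
      (BdRPlus p W (algebraMap B W ξ))).comp (baseChangeToLoc p W ξ ⊤)) fun x => ?_
    rw [hc, AlgHom.comp_apply, baseChangeToLoc_tmul, one_smul]
    rfl
  · have := hc (1 ⊗ₜ x)
    rwa [baseChangeToRelCris_one_tmul, baseChangeToLoc_tmul, one_smul] at this

/-- The isomorphism `𝔸_inf(R') ⊗ A_cris^{0,(m)} ≃ 𝔸_cris^{0,(m)}(R')`. -/
def baseChangeEquiv {m : ℕ∞} (hm : 1 ≤ m) :
    W ⊗[B] dpSub p B ξ m ≃ₐ[W] dpSub p W (algebraMap B W ξ) m :=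
  (AlgEquiv.ofInjective _ (baseChangeToLoc_injective p m hm h)).trans
    (Subalgebra.equivOfEq _ _ (baseChangeToLoc_range p m hm h))

theorem coe_baseChangeEquiv {m : ℕ∞} (hm : 1 ≤ m) (x : W ⊗[B] dpSub p B ξ m) :
    (baseChangeEquiv h hm x : Localization.Away (p : W)) = baseChangeToLoc p W ξ m x := rfl

theorem isCompletionMap_iff {m : ℕ∞} (hm : 1 ≤ m)
    {a : dpSub p W (algebraMap B W ξ) m →ₐ[W] RelCris p B W ξ μ m} :
    IsCompletionMap p B W ξ μ m a ↔
      ∀ x, a (baseChangeEquiv h hm x) = baseChangeToRelCris p W ξ μ m x := by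
  constructor
  · intro ha
    have key : a.comp (baseChangeEquiv h hm).toAlgHom = baseChangeToRelCris p W ξ μ m := by
      refine Algebra.TensorProduct.ext' fun w x => ?_
      have h1 : a (baseChangeEquiv h hm (1 ⊗ₜ x)) = toRelCris p B W ξ μ m x := ha x _ (by
        rw [coe_baseChangeEquiv, baseChangeToLoc_tmul, one_smul])
      rw [baseChangeToRelCris_tmul, ← h1, ← map_smul, ← map_smul, TensorProduct.smul_tmul',
        smul_eq_mul, mul_one]
      rfl
    exact fun x => DFunLike.congr_fun key x
  · intro ha x y hxy
    have : baseChangeEquiv h hm (1 ⊗ₜ x) = y := Subtype.ext (by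
      rw [coe_baseChangeEquiv, baseChangeToLoc_tmul, one_smul, hxy])
    rw [← this, ha, baseChangeToRelCris_one_tmul]

theorem existsUnique_isCompletionMap {m : ℕ∞} (hm : 1 ≤ m) :
    ∃! a, IsCompletionMap p B W ξ μ m a := by
  refine ⟨(baseChangeToRelCris p W ξ μ m).comp (baseChangeEquiv h hm).symm.toAlgHom,
    (isCompletionMap_iff h hm).2 fun x => ?_, fun a ha => ?_⟩
  · exact congrArg (baseChangeToRelCris p W ξ μ m) ((baseChangeEquiv h hm).symm_apply_apply x)
  · ext y : 1
    obtain ⟨x, rfl⟩ := (baseChangeEquiv h hm).surjective y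
    refine ((isCompletionMap_iff h hm).1 ha x).trans ?_
    exact congrArg (baseChangeToRelCris p W ξ μ m)
      ((baseChangeEquiv h hm).symm_apply_apply x).symm

theorem injective_of_isCompletionMap {m : ℕ∞} (hm : 1 ≤ m) (h1 : ξ ∣ μ)
    (h2 : ξ ^ 2 ∈ Ideal.span {(p : B), μ})
    {a : dpSub p W (algebraMap B W ξ) m →ₐ[W] RelCris p B W ξ μ m}
    (ha : IsCompletionMap p B W ξ μ m a) : Function.Injective a := by
  obtain ⟨c, hc, -, -⟩ := exists_relCris_deRham h hm h1 h2
  -- Following `a` by the map to `𝔹_dR^+` recovers the inclusion through `W[1/p]`, which is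
  -- injective because `W[1/p]` is `ξ`-adically separated.
  have key : ∀ y, c (a y) = algebraMap (Localization.Away (p : W)) _ (y : _) := by
    intro y
    obtain ⟨x, rfl⟩ := (baseChangeEquiv h hm).surjective y
    rw [(isCompletionMap_iff h hm).1 ha x, hc, coe_baseChangeEquiv]
  intro y y' e
  have := congrArg c e
  rw [key, key] at this
  exact Subtype.ext (h.algebraMap_bdRPlus_injective this)

omit h hp [IsAdicComplete (Ideal.span {(p : B)}) B] in
theorem relCrisMap_toRelCris {m m' : ℕ∞} (hm : m ≤ m') (x : dpSub p B ξ m) :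
    relCrisMap p B W ξ μ hm (toRelCris p B W ξ μ m x) =
      toRelCris p B W ξ μ m' (Subalgebra.inclusion (dpSub_mono p B ξ hm) x) := by
  have h1 := completionMap_of (pMuIdeal p B μ (dpSub p B ξ m)) (pMuIdeal p B μ (dpSub p B ξ m'))
    (Subalgebra.inclusion (dpSub_mono p B ξ hm)) (pMuIdeal_le_comap p B μ _) x
  refine (completionMap_of _ _ _ _ _).trans ?_
  rw [Algebra.TensorProduct.map_tmul, crisHatMap, h1]
  rfl

omit h hp [IsAdicComplete (Ideal.span {(p : B)}) B] in
theorem relCrisMap_baseChangeToRelCris {m m' : ℕ∞} (hm : m ≤ m')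
    (x : W ⊗[B] dpSub p B ξ m) :
    relCrisMap p B W ξ μ hm (baseChangeToRelCris p W ξ μ m x) =
      baseChangeToRelCris p W ξ μ m' (Algebra.TensorProduct.map (AlgHom.id W W)
        (Subalgebra.inclusion (dpSub_mono p B ξ hm)) x) := by
  refine baseChangeToRelCris_ext (g := (baseChangeToRelCris p W ξ μ m').comp
    (Algebra.TensorProduct.map (AlgHom.id W W)
      (Subalgebra.inclusion (dpSub_mono p B ξ hm)))) (fun x => ?_) x
  rw [relCrisMap_toRelCris, AlgHom.comp_apply, Algebra.TensorProduct.map_tmul]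
  rfl

theorem relCrisMap_top_injective {m : ℕ∞} (hm : 1 ≤ m) (h1 : ξ ∣ μ)
    (h2 : ξ ^ 2 ∈ Ideal.span {(p : B), μ}) :
    Function.Injective (relCrisMap p B W ξ μ (le_top : m ≤ ⊤)) := by
  obtain ⟨c, hc, hcinj, hc'⟩ := exists_relCris_deRham h hm h1 h2
  obtain ⟨d, hd, -, hd'⟩ := exists_relCris_deRham h le_top h1 h2 (m := ⊤)
  refine h.injective_of_dense (map_dvd _ h1) _
    (exists_sub_baseChangeToRelCris_mem_pow p W ξ μ m) hcinj (fun x => ?_) hc' hd'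
  rw [hc, relCrisMap_baseChangeToRelCris, hd]
  congr 1
  induction x using TensorProduct.induction_on with
  | zero => simp
  | tmul w s =>
    rw [Algebra.TensorProduct.map_tmul, baseChangeToLoc_tmul, baseChangeToLoc_tmul]
    rfl
  | add x y hx hy => rw [map_add, map_add, hx, hy, map_add]

end Canonical

end AcrisInj

end

/-! ### The theorem -/

set_option maxHeartbeats 1000000 in
open AcrisInj in
theorem mainTheorem7 (p : ℕ) [Fact p.Prime]
    (C : Type*) [NormedField C] [IsUltrametricDist C] [CompleteSpace C] [IsAlgClosed C]
    [CharZero C] [Fact (‖(p : C)‖ < 1)] (ζ : RootSystem p C)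
    (A : Type*) [NormedCommRing A] [NormedAlgebra C A] [IsUltrametricDist A] [CompleteSpace A]
    [Nontrivial A] (P : AffinoidPerfectoid p C A) (m : ℕ) (hm : 1 ≤ m) :
    (∃! a, IsCompletionMap p (Ainf p C) P.AAinf ζ.xi ζ.mu m a) ∧
    (∃! c, IsDeRhamMap p (Ainf p C) P.AAinf ζ.xi ζ.mu c) ∧
    (∀ a, IsCompletionMap p (Ainf p C) P.AAinf ζ.xi ζ.mu m a → Function.Injective a) ∧
    Function.Injective
      (relCrisMap p (Ainf p C) P.AAinf ζ.xi ζ.mu (le_top : (m : ℕ∞) ≤ ⊤)) ∧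
    (∀ c, IsDeRhamMap p (Ainf p C) P.AAinf ζ.xi ζ.mu c → Function.Injective c) ∧
    (∀ x : dpSub p P.AAinf (algebraMap (Ainf p C) P.AAinf ζ.xi) m,
      algebraMap (Ainf p C) P.AAinf ζ.mu • x = 0 → x = 0) ∧
    (∀ x : RelCris p (Ainf p C) P.AAinf ζ.xi ζ.mu m,
      algebraMap (Ainf p C) P.AAinf ζ.mu • x = 0 → x = 0) ∧
    (∀ x : RelCris p (Ainf p C) P.AAinf ζ.xi ζ.mu ⊤,
      algebraMap (Ainf p C) P.AAinf ζ.mu • x = 0 → x = 0) ∧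
    (∀ x : BdRPlus p P.AAinf (algebraMap (Ainf p C) P.AAinf ζ.xi),
      algebraMap (Ainf p C) P.AAinf ζ.mu • x = 0 → x = 0) := by
  have h := P.isRegularSeparated_xi ζ
  have hm' : (1 : ℕ∞) ≤ m := by exact_mod_cast hm
  have hBdR : ∀ x : BdRPlus p P.AAinf (algebraMap (Ainf p C) P.AAinf ζ.xi),
      algebraMap (Ainf p C) P.AAinf ζ.mu • x = 0 → x = 0 := fun x hx => by
    have ht := map_dvd (algebraMap (Ainf p C) P.AAinf) ζ.tau_sub_one_dvd
    rw [map_sub _ ζ.xi, map_natCast] at ht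
    rw [← ζ.tau_sub_one_mul_xi, map_mul] at hx
    exact h.eq_zero_of_mu_smul ht hx
  have htors : ∀ m : ℕ∞, 1 ≤ m → ∀ x : RelCris p (Ainf p C) P.AAinf ζ.xi ζ.mu m,
      algebraMap (Ainf p C) P.AAinf ζ.mu • x = 0 → x = 0 := fun m hm => by
    obtain ⟨c, -, hc, -⟩ := exists_relCris_deRham h hm ζ.xi_dvd_mu ζ.xi_sq_mem
    exact eq_zero_of_smul_eq_zero hc hBdR
  obtain ⟨c, hc1, hc2, hc3⟩ := exists_relCris_deRham h le_top ζ.xi_dvd_mu ζ.xi_sq_mem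
  have huniq : ∀ c', IsDeRhamMap p (Ainf p C) P.AAinf ζ.xi ζ.mu c' → c' = c := fun c' hc' =>
    have h' := isDeRhamMap_iff.1 hc'
    eq_of_isDeRhamMap h ζ.xi_dvd_mu (fun x => (h'.1 x).trans (hc1 x).symm) h'.2 hc3
  have hainj := fun a (ha : IsCompletionMap p (Ainf p C) P.AAinf ζ.xi ζ.mu m a) =>
    injective_of_isCompletionMap h hm' ζ.xi_dvd_mu ζ.xi_sq_mem ha
  have ha := existsUnique_isCompletionMap (μ := ζ.mu) h hm'
  refine ⟨ha, ⟨c, isDeRhamMap_iff.2 ⟨hc1, hc3⟩, huniq⟩, hainj,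
    relCrisMap_top_injective h hm' ζ.xi_dvd_mu ζ.xi_sq_mem, fun c' hc' => huniq c' hc' ▸ hc2,
    ?_, htors m hm', htors ⊤ le_top, hBdR⟩
  obtain ⟨a, ha, -⟩ := ha
  exact eq_zero_of_smul_eq_zero (hainj a ha) (htors m hm')
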